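/- Let $\mu_d$ denote Lebesgue measure on $\mathbb{R}^d$. If $A$ is a $k$-dimensional affine subspace of $\mathbb{R}^d$, let $\mu_{k,A}$ denote $k$-dimensional Lebesgue measure on $A$, and let $\mathcal{F}_{k,A}$ be the class of upper semi-continuous, log-concave probability densities $f:A\to[0,\infty)$ with respect to $\mu_{k,A}$; write $\mathcal{F}_d=\mathcal{F}_{d,\mathbb{R}^d}$. For a function $f:A\to[0,\infty]$, let $\mathrm{cl}(f)(x)=\limsup_{y\to x,\,y\in A}f(y)$ denote its closure on $A$ (where $y=x$ is allowed). The convex support $\mathrm{csupp}(\nu)$ of a probability measure $\nu$ on $\mathbb{R}^d$ is the smallest closed convex set of $\nu$-measure $1$, and $\mathrm{aff}$ denotes the affine hull. The dimension of a nonempty convex set is that of its affine hull, and $\dim(\emptyset)=-1$. Let $f_1,f_2,\ldots$ be a sequence in $\mathcal{F}_d$, and let $\nu_n$ be the probability measure on $\mathbb{R}^d$ with density $f_n$. Suppose that $\nu_n$ converges weakly to a probability measure $\nu$ on $\mathbb{R}^d$, and let $C=\{x\in\mathbb{R}^d:\liminf_{n\to\infty} f_n(x)>0\}$ (the $\liminf$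 may be $+\infty$). 1. If $\dim(C)=d-1$, then for every compact set $S\subseteq\mathbb{R}^d$ with $S\cap\mathrm{aff}(C)=\emptyset$ we have $\sup_{x\in S}f_n(x)\to 0$ as $n\to\infty$ (with $\sup_\emptyset=0$); moreover, $\mathrm{csupp}(\nu)\subseteq\mathrm{aff}(C)$. 2. (Without any assumption on $\dim(C)$.) Let $U$ be the linear subspace of $\mathbb{R}^d$ such that $\mathrm{aff}(\mathrm{csupp}(\nu))=U+a$ for some $a\in\mathbb{R}^d$, let $k=\dim(U)$, and let $U^\perp$ be the orthogonal complement of $U$. Let $f_{n,U}:U+a\to[0,\infty)$ be the closure on $U+a$ of the function $$x\mapsto\int_{U^\perp}f_n(x+w)\,dw,\qquad x\in U+a.$$ Then $\nu$ is absolutely continuous with respect to $\mu_{k,U+a}$, with Radon--Nikodym derivative $\mathrm{cl}(\liminf_{n\to\infty} f_{n,U})$, and $\mathrm{cl}(\liminf_{n\to\infty} f_{n,U})\in\mathcal{F}_{k,U+a}$. -/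

import Mathlib

open MeasureTheory Filter Topology Set
open scoped ENNReal

/-- The dimension of a (convex) set: the dimension of its affine hull, with `dim ∅ = -1`. -/
noncomputable def convexDim {d : ℕ} (s : Set (EuclideanSpace ℝ (Fin d))) : ℤ :=
  open Classical in if s.Nonempty then (Module.finrank ℝ (vectorSpan ℝ s) : ℤ) else -1

/-- Lebesgue measure on a linear subspace `U` of `ℝ^d`, for the inner product that `U` inherits:
the translation-invariant measure giving mass `1` to the cubes spanned by orthonormal bases.
The `MeasureSpace` structure is named explicitly, since a subspace is also a subtype, and the
subtype measure (the trace of `d`-dimensional Lebesgue measure) is not meant. -/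
noncomputable def lebesgueSub {d : ℕ} (U : Submodule ℝ (EuclideanSpace ℝ (Fin d))) : Measure U :=
  (measureSpaceOfInnerProductSpace (E := U)).volume

instance lebesgueSub_isAddHaarMeasure {d : ℕ} (U : Submodule ℝ (EuclideanSpace ℝ (Fin d))) :
    (lebesgueSub U).IsAddHaarMeasure :=
  inferInstanceAs ((stdOrthonormalBasis ℝ U).toBasis.addHaar).IsAddHaarMeasure

/-- Lebesgue measure on an affine subspace `A` of `ℝ^d`, regarded as a measure on `ℝ^d` carried
by `A`: the image of Lebesgue measure on the direction `U` of `A` under `u ↦ u + a`, for a point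
`a` of `A` (the choice of `a` is immaterial, see `lebesgueOn_eq`). -/
noncomputable def lebesgueOn {d : ℕ} (A : AffineSubspace ℝ (EuclideanSpace ℝ (Fin d))) :
    Measure (EuclideanSpace ℝ (Fin d)) :=
  open Classical in
  if h : (A : Set (EuclideanSpace ℝ (Fin d))).Nonempty then
    (lebesgueSub A.direction).map
      (fun u : A.direction => (u : EuclideanSpace ℝ (Fin d)) + h.some)
  else 0

theorem lebesgueOn_eq {d : ℕ} (A : AffineSubspace ℝ (EuclideanSpace ℝ (Fin d)))
    {a : EuclideanSpace ℝ (Fin d)} (ha : a ∈ A) :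
    lebesgueOn A = (lebesgueSub A.direction).map
      (fun u : A.direction => (u : EuclideanSpace ℝ (Fin d)) + a) := by
  have h : (A : Set (EuclideanSpace ℝ (Fin d))).Nonempty := ⟨a, ha⟩
  have hv : h.some - a ∈ A.direction := AffineSubspace.vsub_mem_direction h.some_mem ha
  have key := MeasureTheory.map_add_right_eq_self (lebesgueSub A.direction) ⟨h.some - a, hv⟩
  rw [lebesgueOn, dif_pos h]
  conv_rhs => rw [← key]
  rw [Measure.map_map (by fun_prop) (by fun_prop)]
  congr 1
  funext u
  simp [add_assoc]

/-- `f` is an upper semi-continuous, log-concave probability density on `A` with respect to `μ`,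
with values in `[0, ∞)`. Only the values of `f` on `A` matter when `μ` is carried by `A`. -/
structure IsLogConcaveDensity {d : ℕ} (A : Set (EuclideanSpace ℝ (Fin d)))
    (μ : Measure (EuclideanSpace ℝ (Fin d))) (f : EuclideanSpace ℝ (Fin d) → ℝ≥0∞) : Prop where
  ne_top : ∀ x ∈ A, f x ≠ ∞
  upperSemicontinuousOn : UpperSemicontinuousOn f A
  logConcave : ∀ x ∈ A, ∀ y ∈ A, ∀ s t : ℝ, 0 < s → 0 < t → s + t = 1 →
    f x ^ s * f y ^ t ≤ f (s • x + t • y)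
  lintegral_eq_one : ∫⁻ x, f x ∂μ = 1

/-- The closure relative to `A` of a function on `A`: `cl(f)(x) = limsup_{y → x, y ∈ A} f(y)`,
where `y = x` is allowed. It is zero outside the topological closure of `A`. -/
noncomputable def clOn {d : ℕ} (A : Set (EuclideanSpace ℝ (Fin d)))
    (f : EuclideanSpace ℝ (Fin d) → ℝ≥0∞) (x : EuclideanSpace ℝ (Fin d)) : ℝ≥0∞ :=
  limsup f (𝓝[A] x)

/-- The convex support of `ν`: the smallest closed convex set of `ν`-measure `1`
(see `isLeast_csupp`). -/
def csupp {d : ℕ} (ν : Measure (EuclideanSpace ℝ (Fin d))) : Set (EuclideanSpace ℝ (Fin d)) :=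
  ⋂₀ {K | IsClosed K ∧ Convex ℝ K ∧ ν K = 1}

theorem isLeast_csupp {d : ℕ} (ν : Measure (EuclideanSpace ℝ (Fin d))) [IsProbabilityMeasure ν] :
    IsLeast {K | IsClosed K ∧ Convex ℝ K ∧ ν K = 1} (csupp ν) := by
  refine ⟨⟨isClosed_sInter fun K hK => hK.1, convex_sInter fun K hK => hK.2.1, ?_⟩,
    fun K hK => sInter_subset_of_mem hK⟩
  obtain ⟨T, hTc, hT⟩ := TopologicalSpace.isOpen_iUnion_countable
    (fun K : {K : Set (EuclideanSpace ℝ (Fin d)) | IsClosed K ∧ Convex ℝ K ∧ ν K = 1} =>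
      (K : Set (EuclideanSpace ℝ (Fin d)))ᶜ) (fun K => K.2.1.isOpen_compl)
  have hcl : IsClosed (csupp ν) := isClosed_sInter fun K hK => hK.1
  rw [← prob_compl_eq_zero_iff hcl.measurableSet, csupp, sInter_eq_iInter, compl_iInter, ← hT,
    measure_biUnion_null_iff hTc]
  exact fun K _ => (prob_compl_eq_zero_iff K.2.1.measurableSet).2 K.2.2.2

/-- The closed marginal of `f` on the affine subspace `A` with direction `U`: the closure in `A`
of `x ↦ ∫_{U^⊥} f(x + w) dw`. -/
noncomputable def marginalOn {d : ℕ} (A : AffineSubspace ℝ (EuclideanSpace ℝ (Fin d)))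
    (f : EuclideanSpace ℝ (Fin d) → ℝ≥0∞) : EuclideanSpace ℝ (Fin d) → ℝ≥0∞ :=
  clOn A (fun x => ∫⁻ w, f (x + (w : EuclideanSpace ℝ (Fin d))) ∂(lebesgueSub A.directionᗮ))

/-! Suppose first that `ν.support` affinely spans the space. Near each of finitely many spanning
support points, weak convergence produces points, depending on `n`, where `f n` is bounded below.
Log-concavity passes the bound to their convex hull, which contains a fixed ball, so `f n ≥ c` on
that ball for large `n`. Total mass one then forces `f n ≤ M` (`exists_ball_bounds`).

Near an interior point `x` of `C` there is again a uniform lower bound `c'`, and log-concavity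
compares `f n x` with nearby values up to a factor `(c' / M) ^ σ` independent of `n`. Hence `f n x`
is squeezed between averages of `νs n` over small balls, and it converges as `σ → 0`. Off `closure
C` the values tend to `0`, and the frontier of the convex set `C` is null. Domination by `M` on sets
of finite volume, with Fatou for the total mass, identifies `ν` with the measure of density `liminf
f n` (`limit_eq_withDensity_liminf`).

In general, project orthogonally to the affine hull of `csupp ν`. The projected measures have the
marginals as densities, these are log-concave by Prékopa's theorem, and the projected limit has
full-dimensional support.

If `C` spans a hyperplane, one more limit point off it at which the densities stay bounded below
would again give a ball with a uniform lower bound. For the whole sequence this puts interior into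
`C`; along a subsequence it gives `ν` mass off the hyperplane. Both are impossible. -/

/-! ### Log-concave functions and their upper semicontinuous envelopes. -/

/-- Log-concavity of an extended nonnegative function on a real vector space. -/
def LogConcave {E : Type*} [AddCommGroup E] [Module ℝ E] (u : E → ℝ≥0∞) : Prop :=
  ∀ x y : E, ∀ s t : ℝ, 0 < s → 0 < t → s + t = 1 → u x ^ s * u y ^ t ≤ u (s • x + t • y)

/-- Serves when `A` and `B` are lower limits, upper limits or suprema, which are accessible only
through what lies strictly below them. -/
theorem rpow_mul_rpow_le_of_forall_lt {A B c : ℝ≥0∞} {s t : ℝ} (hs : 0 < s) (ht : 0 < t)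
    (h : ∀ a < A, ∀ b < B, a ^ s * b ^ t ≤ c) : A ^ s * B ^ t ≤ c := by
  refine ENNReal.mul_le_of_forall_lt fun a ha b hb => ?_
  have ha' : a ^ s⁻¹ < A := (ENNReal.rpow_inv_lt_iff hs).2 ha
  have hb' : b ^ t⁻¹ < B := (ENNReal.rpow_inv_lt_iff ht).2 hb
  simpa only [ENNReal.rpow_inv_rpow hs.ne', ENNReal.rpow_inv_rpow ht.ne'] using h _ ha' _ hb'

theorem rpow_mul_rpow_self {c : ℝ≥0∞} {s t : ℝ} (hs : 0 < s) (ht : 0 < t) (hst : s + t = 1) :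
    c ^ s * c ^ t = c := by
  rw [← ENNReal.rpow_add_of_nonneg s t hs.le ht.le, hst, ENNReal.rpow_one]

/-- The upper semicontinuous envelope of a function. -/
noncomputable def usc {E : Type*} [TopologicalSpace E] (u : E → ℝ≥0∞) (x : E) : ℝ≥0∞ :=
  limsup u (𝓝 x)

section
variable {E F : Type*} [AddCommGroup E] [Module ℝ E] [AddCommGroup F] [Module ℝ F]

theorem LogConcave.convex_ge {u : E → ℝ≥0∞} (hu : LogConcave u) (c : ℝ≥0∞) :
    Convex ℝ {x | c ≤ u x} := by
  rw [convex_iff_forall_pos]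
  intro x hx y hy s t hs ht hst
  calc c = c ^ s * c ^ t := (rpow_mul_rpow_self hs ht hst).symm
    _ ≤ u x ^ s * u y ^ t :=
      mul_le_mul' (ENNReal.rpow_le_rpow hx hs.le) (ENNReal.rpow_le_rpow hy ht.le)
    _ ≤ _ := hu x y s t hs ht hst

theorem LogConcave.convex_gt {u : E → ℝ≥0∞} (hu : LogConcave u) (c : ℝ≥0∞) :
    Convex ℝ {x | c < u x} := by
  rw [convex_iff_forall_pos]
  intro x hx y hy s t hs ht hst
  have h : min (u x) (u y) ≤ u (s • x + t • y) :=
    hu.convex_ge (min (u x) (u y)) (x := x) (min_le_left (u x) (u y)) (y := y)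
      (min_le_right (u x) (u y)) hs.le ht.le hst
  exact (lt_min hx hy : c < min (u x) (u y)).trans_le h

theorem LogConcave.le_of_mem_convexHull {u : E → ℝ≥0∞} (hu : LogConcave u) {c : ℝ≥0∞} {s : Set E}
    (hs : ∀ x ∈ s, c ≤ u x) {y : E} (hy : y ∈ convexHull ℝ s) : c ≤ u y :=
  convexHull_min (t := {x | c ≤ u x}) hs (hu.convex_ge c) hy

theorem LogConcave.comp {u : E → ℝ≥0∞} (hu : LogConcave u) {g : F → E}
    (hg : ∀ x y : F, ∀ s t : ℝ, s + t = 1 → g (s • x + t • y) = s • g x + t • g y) :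
    LogConcave (fun x => u (g x)) := by
  intro x y s t hs ht hst
  simpa only [hg x y s t hst] using hu (g x) (g y) s t hs ht hst

theorem LogConcave.liminf {u : ℕ → E → ℝ≥0∞} (hu : ∀ᶠ n in atTop, LogConcave (u n)) :
    LogConcave (fun x => liminf (fun n => u n x) atTop) := by
  intro x y s t hs ht hst
  refine rpow_mul_rpow_le_of_forall_lt hs ht fun a ha b hb => ?_
  refine le_liminf_of_le (by isBoundedDefault) ?_
  filter_upwards [hu, eventually_lt_of_lt_liminf ha, eventually_lt_of_lt_liminf hb] with n hn h1 h2
  exact (mul_le_mul' (ENNReal.rpow_le_rpow h1.le hs.le)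
    (ENNReal.rpow_le_rpow h2.le ht.le)).trans (hn x y s t hs ht hst)

theorem LogConcave.usc [TopologicalSpace E] [ContinuousAdd E] [ContinuousConstSMul ℝ E]
    {u : E → ℝ≥0∞} (hu : LogConcave u) : LogConcave (usc u) := by
  intro x y s t hs ht hst
  refine rpow_mul_rpow_le_of_forall_lt hs ht fun a ha b hb => ?_
  have ha' := frequently_lt_of_lt_limsup (by isBoundedDefault) ha
  have hb' := frequently_lt_of_lt_limsup (by isBoundedDefault) hb
  refine le_limsup_of_frequently_le ?_ (by isBoundedDefault)
  rw [frequently_iff]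
  intro W hW
  have hc : Tendsto (fun p : E × E => s • p.1 + t • p.2) (𝓝 x ×ˢ 𝓝 y) (𝓝 (s • x + t • y)) := by
    rw [← nhds_prod_eq]
    exact Continuous.tendsto (f := fun p : E × E => s • p.1 + t • p.2) (by fun_prop) (x, y)
  obtain ⟨P, hP, Q, hQ, hPQ⟩ := mem_prod_iff.1 (hc hW)
  obtain ⟨x', hx', hax⟩ := frequently_iff.1 ha' hP
  obtain ⟨y', hy', hby⟩ := frequently_iff.1 hb' hQ
  exact ⟨s • x' + t • y', hPQ (mk_mem_prod hx' hy'), (mul_le_mul' (ENNReal.rpow_le_rpow hax.le hs.le)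
    (ENNReal.rpow_le_rpow hby.le ht.le)).trans (hu x' y' s t hs ht hst)⟩

end

section
variable {E : Type*} [TopologicalSpace E]

theorem le_usc (u : E → ℝ≥0∞) (x : E) : u x ≤ usc u x := by
  refine le_limsup_of_frequently_le ?_ (by isBoundedDefault)
  rw [frequently_iff]
  exact fun hU => ⟨x, mem_of_mem_nhds hU, le_rfl⟩

theorem usc_le_of_eventually_le {u : E → ℝ≥0∞} {x : E} {c : ℝ≥0∞}
    (h : ∀ᶠ y in 𝓝 x, u y ≤ c) : usc u x ≤ c :=
  limsup_le_of_le (by isBoundedDefault) h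

theorem upperSemicontinuous_usc (u : E → ℝ≥0∞) :
    UpperSemicontinuous (usc u) := by
  intro x c hc
  obtain ⟨c', hc', hcc⟩ := exists_between hc
  have h : ∀ᶠ y in 𝓝 x, u y < c' := eventually_lt_of_limsup_lt hc'
  filter_upwards [eventually_eventually_nhds.2 h] with y hy
  exact (usc_le_of_eventually_le (hy.mono fun _ h => h.le)).trans_lt hcc

end

/-! ### The Prékopa–Leindler inequality and Prékopa's theorem. -/

/-- One-dimensional Brunn–Minkowski. Lengths are bounded by suprema of differences of two points,
and a segment in `A` with a segment in `B` yields a segment in `C` whose length is the weighted sum.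
-/
theorem volume_real_add_le_of_convex {A B C : Set ℝ} (hA : Convex ℝ A) (hB : Convex ℝ B)
    (hA0 : A.Nonempty) (hB0 : B.Nonempty) {s t : ℝ} (hs : 0 < s) (ht : 0 < t)
    (h : ∀ x ∈ A, ∀ y ∈ B, s * x + t * y ∈ C) :
    ENNReal.ofReal s * volume A + ENNReal.ofReal t * volume B ≤ volume C := by
  have key : ∀ D : Set ℝ, volume D ≤ ⨆ p : D × D, ENNReal.ofReal (p.2.1 - p.1.1) := by
    intro D
    refine (Real.volume_le_diam D).trans (Metric.ediam_le fun x hx y hy => ?_)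
    rw [edist_dist, Real.dist_eq]
    rcases le_total x y with hxy | hxy
    · rw [abs_sub_comm, abs_of_nonneg (sub_nonneg.2 hxy)]
      exact le_iSup_of_le (⟨x, hx⟩, ⟨y, hy⟩) le_rfl
    · rw [abs_of_nonneg (sub_nonneg.2 hxy)]
      exact le_iSup_of_le (⟨y, hy⟩, ⟨x, hx⟩) le_rfl
  have := hA0.to_subtype
  have := hB0.to_subtype
  refine (add_le_add (mul_le_mul_right (key A) _) (mul_le_mul_right (key B) _)).trans ?_
  rw [ENNReal.mul_iSup, ENNReal.mul_iSup]
  refine ENNReal.iSup_add_iSup_le fun p q => ?_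
  obtain ⟨⟨x, hx⟩, ⟨x', hx'⟩⟩ := p
  obtain ⟨⟨y, hy⟩, ⟨y', hy'⟩⟩ := q
  simp only
  rw [← ENNReal.ofReal_mul hs.le, ← ENNReal.ofReal_mul ht.le]
  have conv_aux : ∀ x x' y y' : ℝ, x ∈ A → x' ∈ A → y ∈ B → y' ∈ B →
      ENNReal.ofReal (s * (x' - x) + t * (y' - y)) ≤ volume C := by
    intro x x' y y' hx hx' hy hy'
    have hsub : segment ℝ (s * x + t * y) (s * x' + t * y') ⊆ C := by
      rintro _ ⟨a, b, ha, hb, hab, rfl⟩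
      have := h _ (hA hx hx' ha hb hab) _ (hB hy hy' ha hb hab)
      simp only [smul_eq_mul] at this ⊢
      convert this using 1
      ring
    rcases le_total (s * x + t * y) (s * x' + t * y') with hle | hle
    · rw [segment_eq_Icc hle] at hsub
      refine le_trans ?_ (measure_mono hsub)
      rw [Real.volume_Icc]
      exact ENNReal.ofReal_le_ofReal (by linarith)
    · rw [ENNReal.ofReal_of_nonpos (by linarith)]
      exact zero_le
  -- A negative difference is truncated to `0` by `ENNReal.ofReal`, so its pair may be replaced by a
  -- repeated point.
  rcases le_total x x' with h1 | h1 <;> rcases le_total y y' with h2 | h2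
  · rw [← ENNReal.ofReal_add (mul_nonneg hs.le (sub_nonneg.2 h1))
      (mul_nonneg ht.le (sub_nonneg.2 h2))]
    exact conv_aux x x' y y' hx hx' hy hy'
  · rw [ENNReal.ofReal_of_nonpos (p := t * (y' - y))
      (mul_nonpos_of_nonneg_of_nonpos ht.le (sub_nonpos.2 h2)), add_zero]
    simpa using conv_aux x x' y y hx hx' hy hy
  · rw [ENNReal.ofReal_of_nonpos (p := s * (x' - x))
      (mul_nonpos_of_nonneg_of_nonpos hs.le (sub_nonpos.2 h1)), zero_add]
    simpa using conv_aux x x y y' hx hx hy hy'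
  · rw [ENNReal.ofReal_of_nonpos (p := t * (y' - y))
      (mul_nonpos_of_nonneg_of_nonpos ht.le (sub_nonpos.2 h2)),
      ENNReal.ofReal_of_nonpos (p := s * (x' - x))
      (mul_nonpos_of_nonneg_of_nonpos hs.le (sub_nonpos.2 h1)), add_zero]
    exact zero_le

theorem volume_Ioi_inter_ofReal_lt (w : ℝ≥0∞) :
    volume.restrict (Ioi (0 : ℝ)) {τ : ℝ | ENNReal.ofReal τ < w} = w := by
  rw [Measure.restrict_apply (measurableSet_lt ENNReal.measurable_ofReal measurable_const)]
  induction w with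
  | top => simp
  | coe w =>
    have : {τ : ℝ | ENNReal.ofReal τ < w} ∩ Ioi 0 = Ioo 0 (w : ℝ) := by
      ext τ
      simp only [mem_inter_iff, mem_ofPred_eq, mem_Ioi, mem_Ioo]
      constructor
      · rintro ⟨h1, h2⟩
        refine ⟨h2, ?_⟩
        rwa [ENNReal.ofReal_lt_coe_iff] at h1
        exact h2.le
      · rintro ⟨h1, h2⟩
        refine ⟨?_, h1⟩
        rwa [ENNReal.ofReal_lt_coe_iff]
        exact h1.le
    rw [this, Real.volume_Ioo, sub_zero, ENNReal.ofReal_coe_nnreal]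

/-- Layer cake: Tonelli on the region under the graph, infinite values included. -/
theorem lintegral_eq_lintegral_ofReal_lt {α : Type*} [MeasurableSpace α] (μ : Measure α) [SFinite μ]
    {w : α → ℝ≥0∞} (hw : Measurable w) :
    ∫⁻ x, w x ∂μ = ∫⁻ τ in Ioi (0 : ℝ), μ {x | ENNReal.ofReal τ < w x} := by
  have hS : MeasurableSet {p : ℝ × α | ENNReal.ofReal p.1 < w p.2} :=
    measurableSet_lt (ENNReal.measurable_ofReal.comp measurable_fst) (hw.comp measurable_snd)
  have h1 := Measure.prod_apply (μ := volume.restrict (Ioi (0 : ℝ))) (ν := μ) hS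
  have h2 := Measure.prod_apply_symm (μ := volume.restrict (Ioi (0 : ℝ))) (ν := μ) hS
  calc ∫⁻ x, w x ∂μ = ∫⁻ x, volume.restrict (Ioi (0 : ℝ)) {τ : ℝ | ENNReal.ofReal τ < w x} ∂μ := by
        simp_rw [volume_Ioi_inter_ofReal_lt]
    _ = _ := h2.symm.trans h1

theorem rpow_mul_rpow_le_add {s t : ℝ} (hs : 0 < s) (ht : 0 < t) (hst : s + t = 1) (x y : ℝ≥0∞) :
    x ^ s * y ^ t ≤ ENNReal.ofReal s * x + ENNReal.ofReal t * y := by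
  have hc : s⁻¹.HolderConjugate t⁻¹ := by
    rw [Real.holderConjugate_iff]
    refine ⟨(one_lt_inv₀ hs).2 (by linarith), by simpa using hst⟩
  have := ENNReal.young_inequality (x ^ s) (y ^ t) hc
  rwa [ENNReal.rpow_rpow_inv hs.ne', ENNReal.rpow_rpow_inv ht.ne', ENNReal.ofReal_inv_of_pos hs,
    ENNReal.ofReal_inv_of_pos ht, div_eq_mul_inv, div_eq_mul_inv, inv_inv, inv_inv,
    mul_comm x, mul_comm y] at this

/-- With equal suprema, the superlevel sets of `a` and `b` are nonempty for the same levels, so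
Brunn–Minkowski applies level by level. This gives the bound with the arithmetic mean of the
integrals, which dominates the geometric mean. -/
theorem prekopa_real_of_iSup_eq_one {a b c : ℝ → ℝ≥0∞} (ha : ∀ τ, Convex ℝ {x | τ < a x})
    (hb : ∀ τ, Convex ℝ {x | τ < b x}) (hma : Measurable a) (hmb : Measurable b)
    (hmc : Measurable c) {s t : ℝ} (hs : 0 < s) (ht : 0 < t) (hst : s + t = 1)
    (h : ∀ x y, a x ^ s * b y ^ t ≤ c (s * x + t * y)) (ha1 : ⨆ x, a x = 1) (hb1 : ⨆ x, b x = 1) :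
    (∫⁻ x, a x) ^ s * (∫⁻ x, b x) ^ t ≤ ∫⁻ x, c x := by
  refine (rpow_mul_rpow_le_add hs ht hst _ _).trans ?_
  rw [lintegral_eq_lintegral_ofReal_lt volume hma, lintegral_eq_lintegral_ofReal_lt volume hmb,
    lintegral_eq_lintegral_ofReal_lt volume hmc,
    ← lintegral_const_mul' _ _ ENNReal.ofReal_ne_top, ← lintegral_const_mul' _ _ ENNReal.ofReal_ne_top,
    ← lintegral_add_left]
  · refine lintegral_mono fun τ => ?_
    rcases lt_or_ge (ENNReal.ofReal τ) 1 with hτ | hτ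
    · refine volume_real_add_le_of_convex (ha _) (hb _) ?_ ?_ hs ht ?_
      · rw [← ha1] at hτ; exact lt_iSup_iff.1 hτ
      · rw [← hb1] at hτ; exact lt_iSup_iff.1 hτ
      · intro x hx y hy
        refine lt_of_lt_of_le ?_ (h x y)
        rw [← rpow_mul_rpow_self (c := ENNReal.ofReal τ) hs ht hst]
        exact ENNReal.mul_lt_mul (ENNReal.rpow_lt_rpow hx hs) (ENNReal.rpow_lt_rpow hy ht)
    · have e1 : {x | ENNReal.ofReal τ < a x} = ∅ := by
        ext x
        simpa using (le_iSup a x).trans (ha1.le.trans hτ)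
      have e2 : {x | ENNReal.ofReal τ < b x} = ∅ := by
        ext x
        simpa using (le_iSup b x).trans (hb1.le.trans hτ)
      simp [e1, e2]
  · refine Measurable.const_mul (Antitone.measurable fun τ τ' h => measure_mono fun x hx => ?_) _
    exact (ENNReal.ofReal_le_ofReal h).trans_lt hx

/-- By homogeneity: divide `a` and `b` by their suprema `α`, `β` and `c` by `α ^ s * β ^ t`. -/
theorem prekopa_real_of_bounded {a b c : ℝ → ℝ≥0∞} (ha : ∀ τ, Convex ℝ {x | τ < a x})
    (hb : ∀ τ, Convex ℝ {x | τ < b x}) (hma : Measurable a) (hmb : Measurable b)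
    (hmc : Measurable c) {s t : ℝ} (hs : 0 < s) (ht : 0 < t) (hst : s + t = 1)
    (h : ∀ x y, a x ^ s * b y ^ t ≤ c (s * x + t * y)) (ha1 : ⨆ x, a x ≠ ∞) (hb1 : ⨆ x, b x ≠ ∞) :
    (∫⁻ x, a x) ^ s * (∫⁻ x, b x) ^ t ≤ ∫⁻ x, c x := by
  by_cases ha0 : ⨆ x, a x = 0
  · have : ∀ x, a x = 0 := by simpa using ha0
    simp [this, hs]
  by_cases hb0 : ⨆ x, b x = 0
  · have : ∀ x, b x = 0 := by simpa using hb0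
    simp [this, ht]
  set α := ⨆ x, a x
  set β := ⨆ x, b x
  have scale : ∀ {γ : ℝ≥0∞} {v : ℝ → ℝ≥0∞}, γ ≠ 0 → γ ≠ ∞ → (∀ τ, Convex ℝ {x | τ < v x}) →
      ∀ τ, Convex ℝ {x | τ < γ⁻¹ * v x} := by
    intro γ v h0 h1 hv τ
    have : {x | τ < γ⁻¹ * v x} = {x | γ * τ < v x} := by
      ext x
      simp only [mem_ofPred_eq]
      rw [← ENNReal.div_eq_inv_mul, ENNReal.lt_div_iff_mul_lt (Or.inl h0) (Or.inl h1), mul_comm]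
    rw [this]
    exact hv _
  set m := α ^ s * β ^ t
  have hm0 : m ≠ 0 := mul_ne_zero (ENNReal.rpow_pos (pos_iff_ne_zero.2 ha0) ha1).ne'
    (ENNReal.rpow_pos (pos_iff_ne_zero.2 hb0) hb1).ne'
  have hm1 : m ≠ ∞ := ENNReal.mul_ne_top (ENNReal.rpow_ne_top_of_nonneg hs.le ha1)
    (ENNReal.rpow_ne_top_of_nonneg ht.le hb1)
  have hmul : ∀ X Y : ℝ≥0∞, (α⁻¹ * X) ^ s * (β⁻¹ * Y) ^ t = m⁻¹ * (X ^ s * Y ^ t) := by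
    intro X Y
    rw [ENNReal.mul_rpow_of_nonneg _ _ hs.le, ENNReal.mul_rpow_of_nonneg _ _ ht.le,
      ENNReal.inv_rpow, ENNReal.inv_rpow, ENNReal.mul_inv
        (Or.inr (ENNReal.rpow_ne_top_of_nonneg ht.le hb1))
        (Or.inl (ENNReal.rpow_ne_top_of_nonneg hs.le ha1))]
    ring
  have key := prekopa_real_of_iSup_eq_one (a := fun x => α⁻¹ * a x) (b := fun x => β⁻¹ * b x)
    (c := fun x => m⁻¹ * c x) (scale ha0 ha1 ha) (scale hb0 hb1 hb) (hma.const_mul _)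
    (hmb.const_mul _) (hmc.const_mul _) hs ht hst
    (fun x y => by
      rw [hmul]
      exact mul_le_mul_right (h x y) _)
    (by rw [← ENNReal.mul_iSup, ENNReal.inv_mul_cancel ha0 ha1])
    (by rw [← ENNReal.mul_iSup, ENNReal.inv_mul_cancel hb0 hb1])
  rw [lintegral_const_mul _ hma, lintegral_const_mul _ hmb, lintegral_const_mul _ hmc, hmul] at key
  exact (ENNReal.mul_le_mul_iff_right (ENNReal.inv_ne_zero.2 hm1) (ENNReal.inv_ne_top.2 hm0)).1 key

theorem lintegral_eq_iSup_min_natCast {α : Type*} [MeasurableSpace α] (μ : Measure α)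
    {w : α → ℝ≥0∞} (hw : Measurable w) :
    ∫⁻ x, w x ∂μ = ⨆ n : ℕ, ∫⁻ x, min (w x) (n : ℝ≥0∞) ∂μ := by
  rw [← lintegral_iSup (fun n => hw.min measurable_const)]
  · refine lintegral_congr fun x => ?_
    rw [← inf_iSup_eq, ENNReal.iSup_natCast, inf_top_eq]
  · intro m n hmn x
    exact min_le_min_left _ (by exact_mod_cast hmn)

/-- The Prékopa–Leindler inequality on the line, for functions with convex superlevel sets. -/
theorem prekopa_real {a b c : ℝ → ℝ≥0∞} (ha : ∀ τ, Convex ℝ {x | τ < a x})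
    (hb : ∀ τ, Convex ℝ {x | τ < b x}) (hma : Measurable a) (hmb : Measurable b)
    (hmc : Measurable c) {s t : ℝ} (hs : 0 < s) (ht : 0 < t) (hst : s + t = 1)
    (h : ∀ x y, a x ^ s * b y ^ t ≤ c (s * x + t * y)) :
    (∫⁻ x, a x) ^ s * (∫⁻ x, b x) ^ t ≤ ∫⁻ x, c x := by
  have trunc : ∀ {v : ℝ → ℝ≥0∞}, (∀ τ, Convex ℝ {x | τ < v x}) →
      ∀ (n : ℕ) (τ : ℝ≥0∞), Convex ℝ {x | τ < min (v x) (n : ℝ≥0∞)} := by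
    intro v hv n τ
    by_cases hn : τ < (n : ℝ≥0∞)
    · simpa [hn] using hv τ
    · simpa [hn] using convex_empty
  refine rpow_mul_rpow_le_of_forall_lt hs ht fun A hA B hB => ?_
  rw [lintegral_eq_iSup_min_natCast _ hma] at hA
  rw [lintegral_eq_iSup_min_natCast _ hmb] at hB
  obtain ⟨m, hm⟩ := lt_iSup_iff.1 hA
  obtain ⟨n, hn⟩ := lt_iSup_iff.1 hB
  refine (mul_le_mul' (ENNReal.rpow_le_rpow hm.le hs.le) (ENNReal.rpow_le_rpow hn.le ht.le)).trans ?_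
  refine prekopa_real_of_bounded (trunc ha m) (trunc hb n) (hma.min measurable_const)
    (hmb.min measurable_const) hmc hs ht hst (fun x y => ?_) ?_ ?_
  · exact (mul_le_mul' (ENNReal.rpow_le_rpow (min_le_left _ _) hs.le)
      (ENNReal.rpow_le_rpow (min_le_left _ _) ht.le)).trans (h x y)
  · exact ne_top_of_le_ne_top (ENNReal.natCast_ne_top m) (iSup_le fun x => min_le_right _ _)
  · exact ne_top_of_le_ne_top (ENNReal.natCast_ne_top n) (iSup_le fun x => min_le_right _ _)

theorem LogConcave.lintegral_real {E : Type*} [AddCommGroup E] [Module ℝ E] {u : E × ℝ → ℝ≥0∞}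
    (hu : LogConcave u) (hm : ∀ x, Measurable fun r => u (x, r)) :
    LogConcave (fun x => ∫⁻ r, u (x, r)) := by
  intro x y s t hs ht hst
  have hc : ∀ x τ, Convex ℝ {r | τ < u (x, r)} := by
    intro x τ p hp q hq a b ha hb hab
    have := hu.convex_gt τ (x := (x, p)) hp (y := (x, q)) hq ha hb hab
    rw [Prod.smul_mk, Prod.smul_mk, Prod.mk_add_mk, ← add_smul, hab, one_smul] at this
    exact this
  exact prekopa_real (hc x) (hc y) (hm x) (hm y) (hm _) hs ht hst
    fun p q => by simpa using hu (x, p) (y, q) s t hs ht hst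

/-- Prékopa's theorem: marginals of log-concave functions are log-concave. -/
theorem LogConcave.lintegral_pi (m : ℕ) {E : Type*} [AddCommGroup E] [Module ℝ E]
    {u : E × (Fin m → ℝ) → ℝ≥0∞} (hu : LogConcave u) (hm : ∀ x, Measurable fun w => u (x, w)) :
    LogConcave (fun x => ∫⁻ w, u (x, w)) := by
  induction m generalizing E with
  | zero =>
    have h : ∀ x, ∫⁻ w, u (x, w) = u (x, 0) := by
      intro x
      rw [Measure.volume_pi_eq_dirac 0, lintegral_dirac' _ (hm x)]
    simp_rw [h]
    intro x y s t hs ht hst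
    simpa using hu (x, 0) (y, 0) s t hs ht hst
  | succ m ih =>
    have mp := (volume_preserving_piFinSuccAbove (fun _ : Fin (m + 1) => ℝ) 0).symm
    have he : ∀ p : ℝ × (Fin m → ℝ),
        (MeasurableEquiv.piFinSuccAbove (fun _ : Fin (m + 1) => ℝ) 0).symm p = Fin.cons p.1 p.2 :=
      fun p => by simp [MeasurableEquiv.piFinSuccAbove, Fin.insertNthEquiv]
    have hmeas : ∀ x, Measurable fun p : ℝ × (Fin m → ℝ) => u (x, Fin.cons p.1 p.2) := by
      intro x
      simp_rw [← he]
      exact (hm x).comp (MeasurableEquiv.measurable _)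
    have h : ∀ x, ∫⁻ w, u (x, w) = ∫⁻ r : ℝ, ∫⁻ w : Fin m → ℝ, u (x, Fin.cons r w) := by
      intro x
      rw [← mp.lintegral_comp (hm x)]
      simp_rw [he]
      exact lintegral_prod _ (hmeas x).aemeasurable
    simp_rw [h]
    -- The first coordinate joins the parameter space, so the induction hypothesis is used over `E ×
    -- ℝ`; the line case then integrates that coordinate out.
    refine LogConcave.lintegral_real
      (u := fun p : E × ℝ => ∫⁻ w : Fin m → ℝ, u (p.1, Fin.cons p.2 w))
      (ih (u := fun q : (E × ℝ) × (Fin m → ℝ) => u (q.1.1, Fin.cons q.1.2 q.2)) ?_ ?_) ?_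
    · intro x y s t hs ht hst
      have := hu (x.1.1, Fin.cons x.1.2 x.2) (y.1.1, Fin.cons y.1.2 y.2) s t hs ht hst
      convert this using 2
      refine Prod.ext rfl (funext fun i => ?_)
      refine Fin.cases ?_ (fun j => ?_) i <;> simp
    · exact fun p => (hmeas p.1).comp (measurable_prodMk_left (x := p.2))
    · exact fun x => (hmeas x).lintegral_prod_right'

/-! ### Tools for passing to the limit. -/

theorem ENNReal.tendsto_const_rpow_nhdsGT_zero {ρ : ℝ≥0∞} (h0 : ρ ≠ 0) (h1 : ρ ≠ ∞) :
    Tendsto (fun σ : ℝ => ρ ^ σ) (𝓝[>] 0) (𝓝 1) := by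
  lift ρ to NNReal using h1
  have h : ρ ≠ 0 := by simpa using h0
  have : Tendsto (fun σ : ℝ => ρ ^ σ) (𝓝 0) (𝓝 (ρ ^ (0 : ℝ))) :=
    (NNReal.continuousAt_rpow (Or.inl h)).tendsto.comp
      (f := fun σ : ℝ => (ρ, σ)) ((continuous_const.prodMk continuous_id).tendsto' 0 (ρ, 0) rfl)
  rw [NNReal.rpow_zero] at this
  have h2 := (ENNReal.continuous_coe.tendsto 1).comp (this.mono_left (nhdsWithin_le_nhds (s := Ioi 0)))
  refine h2.congr fun σ => ?_
  rw [Function.comp, ENNReal.coe_rpow_of_ne_zero h]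

theorem ENNReal.le_of_forall_rpow_mul_le {ρ a b : ℝ≥0∞} (h0 : ρ ≠ 0) (h1 : ρ ≠ ∞)
    (h : ∀ σ : ℝ, 0 < σ → σ < 1 → ρ ^ σ * a ≤ b) : a ≤ b := by
  have ht := ENNReal.Tendsto.mul_const (b := a) (ENNReal.tendsto_const_rpow_nhdsGT_zero h0 h1)
    (Or.inl one_ne_zero)
  rw [one_mul] at ht
  refine le_of_tendsto ht ?_
  filter_upwards [Ioo_mem_nhdsGT (zero_lt_one' ℝ)] with σ hσ using h σ hσ.1 hσ.2

/-- Weak convergence bounds a limit from above only on open sets by lower limits; outer regularity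
extends the comparison. -/
theorem MeasureTheory.Measure.le_of_forall_isOpen_le {X : Type*} [TopologicalSpace X]
    [MeasurableSpace X] {μ ν : Measure X} [ν.OuterRegular] (h : ∀ O, IsOpen O → μ O ≤ ν O) :
    μ ≤ ν := by
  refine Measure.le_intro fun s _ _ => ?_
  rw [s.measure_eq_iInf_isOpen ν]
  exact le_iInf₂ fun O hs => le_iInf fun hO => (measure_mono hs).trans (h O hO)

theorem exists_mem_le_of_le_withDensity {X : Type*} [MeasurableSpace X] {μ : Measure X}
    {u : X → ℝ≥0∞} {B : Set X} (hB : MeasurableSet B) {ε : ℝ≥0∞}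
    (h : ε < μ.withDensity u B) : ∃ q ∈ B, ε / μ B ≤ u q := by
  by_contra! hlt
  rw [withDensity_apply _ hB] at h
  refine h.not_ge ?_
  calc ∫⁻ x in B, u x ∂μ ≤ ∫⁻ _ in B, ε / μ B ∂μ := setLIntegral_mono' hB fun x hx => (hlt x hx).le
    _ = ε / μ B * μ B := setLIntegral_const _ _
    _ ≤ ε := by rw [mul_comm]; exact ENNReal.mul_div_le

/-! ### Uniform bounds for log-concave functions. -/

section
variable {E : Type*} [NormedAddCommGroup E] [NormedSpace ℝ E]

/-- Separate a missed point `y` from the moved hull by `φ`. Moving the vertices back costs `‖φ‖ *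
R`, and the distance from `y` to `z` costs as much again. The ball of radius `3 * R` then gives `3 *
‖φ‖ ≤ 2 * ‖φ‖`, so `φ = 0`, which separates nothing. -/
theorem closedBall_subset_convexHull_of_dist_le {t : Set E} (ht : t.Finite) {z : E} {R : ℝ}
    (hR : 0 < R) (h : Metric.closedBall z (3 * R) ⊆ convexHull ℝ t) {q : E → E}
    (hq : ∀ p ∈ t, dist (q p) p ≤ R) : Metric.closedBall z R ⊆ convexHull ℝ (q '' t) := by
  intro y hy
  by_contra hy'
  obtain ⟨φ, m, hφ, hm⟩ := geometric_hahn_banach_closed_point (convex_convexHull ℝ (q '' t))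
    ((ht.image q).isClosed_convexHull ℝ) hy'
  have hnorm : ∀ v : E, ‖v‖ ≤ R → φ v ≤ ‖φ‖ * R := fun v hv =>
    (le_abs_self _).trans ((φ.le_opNorm v).trans (mul_le_mul_of_nonneg_left hv (norm_nonneg _)))
  have h1 : ∀ w ∈ convexHull ℝ t, φ w ≤ m + ‖φ‖ * R := by
    intro w hw
    refine convexHull_min (t := {w | φ w ≤ m + ‖φ‖ * R}) ?_
      (convex_halfSpace_le φ.toLinearMap.isLinear _) hw
    intro p hp
    have e1 := hφ _ (subset_convexHull ℝ _ (mem_image_of_mem q hp))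
    have e2 := hnorm (p - q p) (by rw [← dist_eq_norm, dist_comm]; exact hq p hp)
    rw [map_sub] at e2
    show φ p ≤ m + ‖φ‖ * R
    linarith
  have h2 : ∀ v : E, ‖v‖ = 1 → φ v * (3 * R) < 2 * (‖φ‖ * R) := by
    intro v hv
    have e1 := h1 (z + (3 * R) • v) (h (by
      simp [norm_smul, hv, abs_of_pos hR]))
    have e2 := hnorm (y - z) (by rw [← dist_eq_norm]; exact hy)
    rw [map_sub] at e2
    rw [map_add, map_smul, smul_eq_mul] at e1
    linarith
  have h3 : ‖φ‖ ≤ 2 / 3 * ‖φ‖ := by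
    refine ContinuousLinearMap.opNorm_le_of_unit_norm (by positivity) fun v hv => ?_
    have e1 := h2 v hv
    have e2 := h2 (-v) (by rwa [norm_neg])
    rw [map_neg] at e2
    have e3 : φ v ≤ 2 / 3 * ‖φ‖ := le_of_mul_le_mul_right (by linarith) (by linarith : 0 < 3 * R)
    have e4 : -φ v ≤ 2 / 3 * ‖φ‖ := le_of_mul_le_mul_right (by linarith) (by linarith : 0 < 3 * R)
    exact abs_le.2 ⟨by linarith, e3⟩
  have h4 : ‖φ‖ = 0 := le_antisymm (by linarith) (norm_nonneg _)
  have h5 : φ = 0 := norm_eq_zero.1 h4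
  obtain ⟨p, hp⟩ : t.Nonempty := by
    rw [← convexHull_nonempty_iff (𝕜 := ℝ)]
    exact ⟨z, h (Metric.mem_closedBall_self (by positivity))⟩
  have e1 := hφ _ (subset_convexHull ℝ _ (mem_image_of_mem q hp))
  simp only [h5, zero_apply] at e1 hm
  linarith

/-- If every point of a finite affinely spanning set is approximated by points at which the
log-concave functions `u i` are bounded below, then they are bounded below on a common ball. -/
theorem LogConcave.exists_closedBall_lower_bound [FiniteDimensional ℝ E] {ι : Type*} {l : Filter ι}
    {u : ι → E → ℝ≥0∞} (hu : ∀ i, LogConcave (u i)) {t : Set E} (ht : t.Finite)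
    (hspan : affineSpan ℝ t = ⊤)
    (h : ∀ p ∈ t, ∀ r : ℝ, 0 < r → ∃ c : ℝ≥0∞, c ≠ 0 ∧
      ∀ᶠ i in l, ∃ q ∈ Metric.closedBall p r, c ≤ u i q) :
    ∃ z : E, ∃ R : ℝ, 0 < R ∧ ∃ c : ℝ≥0∞, c ≠ 0 ∧
      ∀ᶠ i in l, ∀ y ∈ Metric.closedBall z R, c ≤ u i y := by
  obtain ⟨z, hz⟩ := interior_convexHull_nonempty_iff_affineSpan_eq_top.2 hspan
  obtain ⟨ε, hε, hz⟩ := Metric.nhds_basis_closedBall.mem_iff.1 (mem_interior_iff_mem_nhds.1 hz)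
  have hR : 0 < ε / 3 := by positivity
  have h' : ∀ p : E, ∃ c : ℝ≥0∞, c ≠ 0 ∧ (p ∈ t →
      ∀ᶠ i in l, ∃ q ∈ Metric.closedBall p (ε / 3), c ≤ u i q) := by
    intro p
    by_cases hp : p ∈ t
    · obtain ⟨c, hc, h⟩ := h p hp _ hR
      exact ⟨c, hc, fun _ => h⟩
    · exact ⟨1, one_ne_zero, fun h => absurd h hp⟩
  choose c hc0 hc using h'
  refine ⟨z, ε / 3, hR, ht.toFinset.inf c, ?_, ?_⟩
  · exact ((Finset.lt_inf_iff ENNReal.zero_lt_top).2 fun p _ => pos_iff_ne_zero.2 (hc0 p)).ne'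
  · filter_upwards [(eventually_all_finite ht).2 fun p hp => hc p hp] with i hi y hy
    have hi' : ∀ p : E, ∃ q : E, p ∈ t → q ∈ Metric.closedBall p (ε / 3) ∧ c p ≤ u i q := by
      intro p
      by_cases hp : p ∈ t
      · obtain ⟨q, hq⟩ := hi p hp
        exact ⟨q, fun _ => hq⟩
      · exact ⟨p, fun h => absurd h hp⟩
    choose q hq using hi'
    have hsub := closedBall_subset_convexHull_of_dist_le ht hR (q := q)
      (by rw [mul_div_cancel₀ _ (by norm_num : (3 : ℝ) ≠ 0)]; exact hz) (fun p hp => (hq p hp).1)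
    refine (hu i).le_of_mem_convexHull ?_ (hsub hy)
    rintro _ ⟨p, hp, rfl⟩
    exact (Finset.inf_le (ht.mem_toFinset.2 hp)).trans (hq p hp).2

/-- The hull of `q` and a ball around `z` contains the ball of radius `τ * R` around `(1 - τ) • q +
τ • z`. -/
theorem LogConcave.le_of_mem_cone {u : E → ℝ≥0∞} (hu : LogConcave u) {c : ℝ≥0∞} {z q : E} {R : ℝ}
    (hz : ∀ y ∈ Metric.closedBall z R, c ≤ u y) (hq : c ≤ u q) {τ : ℝ} (h0 : 0 < τ) (h1 : τ ≤ 1)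
    {y : E} (hy : ‖y - ((1 - τ) • q + τ • z)‖ ≤ τ * R) : c ≤ u y := by
  have e : y = (1 - τ) • q + τ • (z + τ⁻¹ • (y - ((1 - τ) • q + τ • z))) := by
    rw [smul_add, smul_inv_smul₀ h0.ne']
    abel
  rw [e]
  refine hu.convex_ge c (x := q) hq (hz _ ?_) (by linarith) h0.le (by ring)
  rw [mem_closedBall_iff_norm, add_sub_cancel_left, norm_smul, Real.norm_eq_abs,
    abs_of_pos (inv_pos.2 h0)]
  rw [inv_mul_le_iff₀ h0]
  exact hy

/-- Moving a fraction `σ` of the way to `w` costs a factor that depends only on `c / M` and tends to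
`1` with `σ → 0`. -/
theorem LogConcave.rpow_mul_le {u : E → ℝ≥0∞} (hu : LogConcave u) {c M : ℝ≥0∞} (hM0 : M ≠ 0)
    (hM : M ≠ ∞) (hle : ∀ y, u y ≤ M) {x w : E} (hw : c ≤ u w) {σ : ℝ} (h0 : 0 < σ) (h1 : σ < 1) :
    (c / M) ^ σ * u x ≤ u ((1 - σ) • x + σ • w) := by
  refine le_trans ?_ (hu x w (1 - σ) σ (by linarith) h0 (by ring))
  calc (c / M) ^ σ * u x = (c / M) ^ σ * (u x ^ (1 - σ) * u x ^ σ) := by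
        rw [rpow_mul_rpow_self (by linarith) h0 (by ring)]
    _ ≤ (c / M) ^ σ * (u x ^ (1 - σ) * M ^ σ) := by gcongr; exact hle x
    _ = u x ^ (1 - σ) * (c / M * M) ^ σ := by rw [ENNReal.mul_rpow_of_nonneg _ _ h0.le]; ring
    _ = u x ^ (1 - σ) * c ^ σ := by rw [ENNReal.div_mul_cancel hM0 hM]
    _ ≤ u x ^ (1 - σ) * u w ^ σ := by gcongr

/-- A multiplicative equicontinuity: each of `x`, `y` lies a fraction `σ` of the way from the other
to a point of the `r`-ball. -/
theorem LogConcave.rpow_mul_le_of_mem_closedBall {u : E → ℝ≥0∞} (hu : LogConcave u) {c M : ℝ≥0∞}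
    (hM0 : M ≠ 0) (hM : M ≠ ∞) (hle : ∀ y, u y ≤ M) {x : E} {r : ℝ}
    (hr : ∀ y ∈ Metric.closedBall x r, c ≤ u y) {σ : ℝ} (h0 : 0 < σ) (h1 : σ < 1) {y : E}
    (hy : y ∈ Metric.closedBall x (σ * r)) :
    (c / M) ^ σ * u x ≤ u y ∧ (c / M) ^ σ * u y ≤ u x := by
  rw [mem_closedBall_iff_norm] at hy
  have hs : ‖σ⁻¹ • (y - x)‖ ≤ r := by
    rw [norm_smul, Real.norm_eq_abs, abs_of_pos (inv_pos.2 h0), inv_mul_le_iff₀ h0]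
    exact hy
  constructor
  · have := hu.rpow_mul_le hM0 hM hle (x := x) (w := x + σ⁻¹ • (y - x)) (hr _ (by
      rwa [mem_closedBall_iff_norm, add_sub_cancel_left])) h0 h1
    have e : (1 - σ) • x + σ • (x + σ⁻¹ • (y - x)) = y := by
      rw [smul_add, smul_inv_smul₀ h0.ne', sub_smul, one_smul]
      abel
    rwa [e] at this
  · have := hu.rpow_mul_le hM0 hM hle (x := y) (w := y - σ⁻¹ • (y - x)) (hr _ (by
      rw [mem_closedBall_iff_norm]
      have e : y - σ⁻¹ • (y - x) - x = -((1 - σ) • (σ⁻¹ • (y - x))) := by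
        rw [sub_smul, one_smul, smul_inv_smul₀ h0.ne']
        abel
      rw [e, norm_neg, norm_smul, Real.norm_eq_abs, abs_of_pos (by linarith)]
      nlinarith [norm_nonneg (σ⁻¹ • (y - x))])) h0 h1
    have e : (1 - σ) • y + σ • (y - σ⁻¹ • (y - x)) = x := by
      rw [smul_sub, smul_inv_smul₀ h0.ne', sub_smul, one_smul]
      abel
    rwa [e] at this

variable [MeasurableSpace E] [BorelSpace E]

/-- A log-concave subprobability density that is bounded below on a ball is bounded above by a
constant that depends on the ball and the lower bound only. -/
theorem LogConcave.exists_upper_bound (μ : Measure E) [μ.IsAddHaarMeasure] {z : E} {R : ℝ}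
    (hR : 0 < R) {c : ℝ≥0∞} (hc : c ≠ 0) : ∃ M : ℝ≥0∞, M ≠ ∞ ∧ ∀ u : E → ℝ≥0∞, LogConcave u →
      ∫⁻ x, u x ∂μ ≤ 1 → (∀ y ∈ Metric.closedBall z R, c ≤ u y) → ∀ x, u x ≤ M := by
  set V := μ (Metric.closedBall (0 : E) (R / 2))
  have hV : V ≠ 0 := (Metric.measure_closedBall_pos μ _ (by positivity)).ne'
  have h2 : (0 : ℝ) < 1 / 2 := by norm_num
  have hc' : c ^ (1 / 2 : ℝ) ≠ 0 := by simpa using hc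
  refine ⟨((c ^ (1 / 2 : ℝ) * V)⁻¹) ^ (2 : ℝ),
    ENNReal.rpow_ne_top_of_nonneg (by norm_num) (ENNReal.inv_ne_top.2 (mul_ne_zero hc' hV)), ?_⟩
  intro u hu hint hz x
  -- Halfway between `x` and the given ball, `u` is at least the geometric mean of `u x` and `c`;
  -- integrating over this half-size ball bounds `u x`.
  have hB : ∀ y ∈ Metric.closedBall ((1 / 2 : ℝ) • x + (1 / 2 : ℝ) • z) (R / 2),
      u x ^ (1 / 2 : ℝ) * c ^ (1 / 2 : ℝ) ≤ u y := by
    intro y hy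
    rw [mem_closedBall_iff_norm] at hy
    have e : y = (1 / 2 : ℝ) • x +
        (1 / 2 : ℝ) • (z + (2 : ℝ) • (y - ((1 / 2 : ℝ) • x + (1 / 2 : ℝ) • z))) := by
      rw [smul_add (1 / 2 : ℝ) z, smul_smul]
      norm_num
      abel
    rw [e]
    refine le_trans ?_ (hu _ _ _ _ h2 h2 (by norm_num))
    gcongr
    refine hz _ ?_
    rw [mem_closedBall_iff_norm, add_sub_cancel_left, norm_smul, Real.norm_eq_abs, abs_two]
    linarith
  have h3 : u x ^ (1 / 2 : ℝ) * (c ^ (1 / 2 : ℝ) * V) ≤ 1 := by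
    refine le_trans ?_ hint
    calc u x ^ (1 / 2 : ℝ) * (c ^ (1 / 2 : ℝ) * V)
        = ∫⁻ _ in Metric.closedBall ((1 / 2 : ℝ) • x + (1 / 2 : ℝ) • z) (R / 2),
            u x ^ (1 / 2 : ℝ) * c ^ (1 / 2 : ℝ) ∂μ := by
          rw [setLIntegral_const, mul_assoc, Measure.addHaar_closedBall_center]
      _ ≤ ∫⁻ y in Metric.closedBall ((1 / 2 : ℝ) • x + (1 / 2 : ℝ) • z) (R / 2), u y ∂μ :=
          setLIntegral_mono' Metric.isClosed_closedBall.measurableSet hB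
      _ ≤ _ := setLIntegral_le_lintegral _ _
  have h4 := ENNReal.rpow_le_rpow (ENNReal.le_inv_iff_mul_le.2 h3) (zero_le_two (α := ℝ))
  rwa [← ENNReal.rpow_mul, one_div_mul_cancel two_ne_zero, ENNReal.rpow_one] at h4

end

/-! ### Weak limits with full-dimensional support. -/

/-- The set where a sequence of functions is eventually bounded away from zero. -/
def posSet {E : Type*} (u : ℕ → E → ℝ≥0∞) : Set E := {x | 0 < liminf (fun n => u n x) atTop}

theorem mem_posSet_of_eventually_le {E : Type*} {u : ℕ → E → ℝ≥0∞} {x : E} {c : ℝ≥0∞} (hc : c ≠ 0)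
    (h : ∀ᶠ n in atTop, c ≤ u n x) : x ∈ posSet u :=
  (pos_iff_ne_zero.2 hc).trans_le (le_liminf_of_le (by isBoundedDefault) h)

theorem exists_eventually_le_of_mem_posSet {E : Type*} {u : ℕ → E → ℝ≥0∞} {x : E} (h : x ∈ posSet u) :
    ∃ c : ℝ≥0∞, c ≠ 0 ∧ ∀ᶠ n in atTop, c ≤ u n x := by
  obtain ⟨c, hc0, hc⟩ := exists_between (show 0 < liminf (fun n => u n x) atTop from h)
  exact ⟨c, hc0.ne', (eventually_lt_of_lt_liminf hc).mono fun _ h => h.le⟩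

section
variable {E : Type*} [NormedAddCommGroup E] [NormedSpace ℝ E]

theorem convex_posSet {u : ℕ → E → ℝ≥0∞} (hu : ∀ n, LogConcave (u n)) : Convex ℝ (posSet u) :=
  (LogConcave.liminf (Eventually.of_forall hu)).convex_gt 0

theorem exists_closedBall_lower_bound_of_mem_interior {u : ℕ → E → ℝ≥0∞}
    (hu : ∀ n, LogConcave (u n)) {z : E} {R : ℝ} (hR : 0 < R) {c : ℝ≥0∞} (hc : c ≠ 0)
    (hlow : ∀ᶠ n in atTop, ∀ y ∈ Metric.closedBall z R, c ≤ u n y) {x : E}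
    (hx : x ∈ interior (posSet u)) : ∃ r : ℝ, 0 < r ∧ ∃ c' : ℝ≥0∞, c' ≠ 0 ∧
      ∀ᶠ n in atTop, ∀ y ∈ Metric.closedBall x r, c' ≤ u n y := by
  -- Extend the segment from `z` slightly beyond `x`, staying in `posSet u`; the cone from that
  -- endpoint over the ball at `z` contains a ball around `x`.
  have h1 : Tendsto (fun τ : ℝ => (1 - τ)⁻¹ • (x - τ • z)) (𝓝[>] 0) (𝓝 x) := by
    have : ContinuousAt (fun τ : ℝ => (1 - τ)⁻¹ • (x - τ • z)) 0 :=
      ((continuousAt_const.sub continuousAt_id).inv₀ (by simp)).smul (by fun_prop)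
    have h := this.tendsto
    simp only [sub_zero, inv_one, one_smul, zero_smul] at h
    exact h.mono_left nhdsWithin_le_nhds
  obtain ⟨τ, hτ, hτ0, hτ1⟩ := ((h1.eventually (mem_interior_iff_mem_nhds.1 hx)).and
    (Ioo_mem_nhdsGT (zero_lt_one' ℝ))).exists
  obtain ⟨c', hc', h'⟩ := exists_eventually_le_of_mem_posSet hτ
  refine ⟨τ * R, mul_pos hτ0 hR, min c c', (lt_min (pos_iff_ne_zero.2 hc)
    (pos_iff_ne_zero.2 hc')).ne', ?_⟩
  filter_upwards [hlow, h'] with n hn hn' y hy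
  refine (hu n).le_of_mem_cone (fun y hy => (min_le_left _ _).trans (hn y hy))
    ((min_le_right _ _).trans hn') hτ0 hτ1.le ?_
  rwa [smul_inv_smul₀ (by linarith), sub_add_cancel, ← mem_closedBall_iff_norm]

variable [MeasurableSpace E] [BorelSpace E]

section
variable {μ : Measure E} [μ.IsAddHaarMeasure] {u : ℕ → E → ℝ≥0∞}
  {νs : ℕ → ProbabilityMeasure E} {ν : ProbabilityMeasure E}

/-- As the support is closed, points of the segment towards `z` suffice. Around such a point the
cone gives a ball on which `u n` is infinitely often bounded below, so the closed-set portmanteau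
inequality gives it mass. -/
theorem mem_support_of_limsup_pos (hu : ∀ n, LogConcave (u n))
    (hνs : ∀ n, (νs n : Measure E) = μ.withDensity (u n)) (hν : Tendsto νs atTop (𝓝 ν))
    {z : E} {R : ℝ} (hR : 0 < R) {c : ℝ≥0∞} (hc : c ≠ 0)
    (hlow : ∀ᶠ n in atTop, ∀ y ∈ Metric.closedBall z R, c ≤ u n y) {x : E}
    (hx : 0 < limsup (fun n => u n x) atTop) : x ∈ (ν : Measure E).support := by
  have h1 : Tendsto (fun τ : ℝ => (1 - τ) • x + τ • z) (𝓝[>] 0) (𝓝 x) :=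
    (Continuous.tendsto' (by fun_prop) _ _ (by simp)).mono_left nhdsWithin_le_nhds
  refine Measure.isClosed_support.mem_of_tendsto h1 ?_
  filter_upwards [Ioo_mem_nhdsGT (zero_lt_one' ℝ)] with τ hτ
  obtain ⟨δ, hδ0, hδ⟩ := exists_between hx
  have hfr := (frequently_lt_of_lt_limsup (by isBoundedDefault) hδ).and_eventually hlow
  set y := (1 - τ) • x + τ • z
  rw [Metric.nhds_basis_closedBall.mem_measureSupport]
  intro r hr
  set ρ := min r (τ * R)
  have hρ : 0 < ρ := lt_min hr (mul_pos hτ.1 hR)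
  have hm : min c δ ≠ 0 := (lt_min (pos_iff_ne_zero.2 hc) hδ0).ne'
  refine lt_of_lt_of_le ?_ (measure_mono (Metric.closedBall_subset_closedBall (min_le_left r (τ * R))))
  refine lt_of_lt_of_le ?_
    (ProbabilityMeasure.limsup_measure_closed_le_of_tendsto hν Metric.isClosed_closedBall)
  refine lt_of_lt_of_le (b := min c δ * μ (Metric.closedBall y ρ))
    (pos_iff_ne_zero.2 (mul_ne_zero hm (Metric.measure_closedBall_pos μ _ hρ).ne')) ?_
  refine le_limsup_of_frequently_le (hfr.mono fun n hn => ?_) (by isBoundedDefault)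
  rw [hνs n, withDensity_apply _ Metric.isClosed_closedBall.measurableSet, ← setLIntegral_const]
  refine setLIntegral_mono' Metric.isClosed_closedBall.measurableSet fun w hw => ?_
  refine (hu n).le_of_mem_cone (q := x) (fun y hy => (min_le_left _ _).trans (hn.2 y hy))
    ((min_le_right _ _).trans hn.1.le) hτ.1 hτ.2.le ?_
  rw [← mem_closedBall_iff_norm]
  exact Metric.closedBall_subset_closedBall (min_le_right r (τ * R)) hw

variable [FiniteDimensional ℝ E]

theorem exists_eventually_le_of_mem_support
    (hνs : ∀ n, (νs n : Measure E) = μ.withDensity (u n)) (hν : Tendsto νs atTop (𝓝 ν))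
    {x : E} (hx : x ∈ (ν : Measure E).support) {r : ℝ} (hr : 0 < r) :
    ∃ c : ℝ≥0∞, c ≠ 0 ∧ ∀ᶠ n in atTop, ∃ q ∈ Metric.closedBall x r, c ≤ u n q := by
  have h0 := (Measure.mem_support_iff_forall x).1 hx _ (Metric.ball_mem_nhds x hr)
  have h1 := h0.trans_le
    (ProbabilityMeasure.le_liminf_measure_open_of_tendsto hν Metric.isOpen_ball)
  obtain ⟨ε, hε0, hε⟩ := exists_between h1
  refine ⟨ε / μ (Metric.closedBall x r), (ENNReal.div_pos hε0.ne' measure_closedBall_lt_top.ne).ne',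
    ?_⟩
  filter_upwards [eventually_lt_of_lt_liminf hε] with n hn
  have hn' := hn.trans_le (measure_mono Metric.ball_subset_closedBall)
  rw [hνs n] at hn'
  exact exists_mem_le_of_le_withDensity Metric.isClosed_closedBall.measurableSet hn'

theorem exists_ball_bounds (hu : ∀ n, LogConcave (u n))
    (hνs : ∀ n, (νs n : Measure E) = μ.withDensity (u n)) (hν : Tendsto νs atTop (𝓝 ν))
    (hfull : affineSpan ℝ (ν : Measure E).support = ⊤) :
    ∃ z : E, ∃ R : ℝ, 0 < R ∧ ∃ c M : ℝ≥0∞, c ≠ 0 ∧ M ≠ 0 ∧ M ≠ ∞ ∧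
      (∀ᶠ n in atTop, ∀ y ∈ Metric.closedBall z R, c ≤ u n y) ∧ ∀ᶠ n in atTop, ∀ y, u n y ≤ M := by
  obtain ⟨t, hts, htspan, hti⟩ := exists_affineIndependent ℝ E (ν : Measure E).support
  have ht : t.Finite := finite_set_of_fin_dim_affineIndependent ℝ hti
  obtain ⟨z, R, hR, c, hc, h⟩ := LogConcave.exists_closedBall_lower_bound hu ht
    (htspan.trans hfull) (fun p hp r hr => exists_eventually_le_of_mem_support hνs hν (hts hp) hr)
  obtain ⟨M, hM, hup⟩ := LogConcave.exists_upper_bound μ (z := z) hR hc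
  refine ⟨z, R, hR, c, max M 1, hc, (zero_lt_one.trans_le (le_max_right _ _)).ne',
    max_ne_top hM ENNReal.one_ne_top, h, ?_⟩
  filter_upwards [h] with n hn y
  refine (hup (u n) (hu n) ?_ hn y).trans (le_max_left _ _)
  rw [← setLIntegral_univ, ← withDensity_apply _ MeasurableSet.univ, ← hνs n, measure_univ]

theorem limit_le_smul (hνs : ∀ n, (νs n : Measure E) = μ.withDensity (u n))
    (hν : Tendsto νs atTop (𝓝 ν)) {M : ℝ≥0∞} (hM : M ≠ ∞)
    (hup : ∀ᶠ n in atTop, ∀ y, u n y ≤ M) : (ν : Measure E) ≤ M • μ := by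
  have := Measure.OuterRegular.smul μ hM
  refine Measure.le_of_forall_isOpen_le fun O hO => ?_
  refine (ProbabilityMeasure.le_liminf_measure_open_of_tendsto hν hO).trans ?_
  refine liminf_le_of_le (by isBoundedDefault) fun b hb => ?_
  obtain ⟨n, h1, h2⟩ := (hb.and hup).exists
  refine h1.trans ?_
  rw [hνs n, withDensity_apply _ hO.measurableSet, Measure.smul_apply, smul_eq_mul]
  exact (lintegral_mono fun y => h2 y).trans_eq (setLIntegral_const _ _)

/-- On a small ball `u n` agrees with `u n x` up to the factor `κ`, while the mass of the ball is
controlled by `ν`, which does not charge spheres. Comparing from above and from below costs `κ ^ 2`,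
which tends to `1` as `σ → 0`. -/
theorem limsup_le_liminf_of_mem_interior (hu : ∀ n, LogConcave (u n))
    (hνs : ∀ n, (νs n : Measure E) = μ.withDensity (u n)) (hν : Tendsto νs atTop (𝓝 ν))
    {M : ℝ≥0∞} (hM0 : M ≠ 0) (hM : M ≠ ∞) (hup : ∀ᶠ n in atTop, ∀ y, u n y ≤ M)
    {x : E} {r : ℝ} (hr : 0 < r) {c : ℝ≥0∞} (hc : c ≠ 0) (hc1 : c ≠ ∞)
    (hlow : ∀ᶠ n in atTop, ∀ y ∈ Metric.closedBall x r, c ≤ u n y) :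
    limsup (fun n => u n x) atTop ≤ liminf (fun n => u n x) atTop := by
  refine ENNReal.le_of_forall_rpow_mul_le (ρ := (c / M) ^ (2 : ℝ))
    (ENNReal.rpow_pos (ENNReal.div_pos hc hM) (ENNReal.div_ne_top hc1 hM0)).ne'
    (ENNReal.rpow_ne_top_of_nonneg zero_le_two (ENNReal.div_ne_top hc1 hM0)) fun σ h0 h1 => ?_
  rw [← ENNReal.rpow_mul, mul_comm (2 : ℝ), ENNReal.rpow_mul, ENNReal.rpow_two]
  set κ := (c / M) ^ σ
  have hκ0 : κ ≠ 0 := (ENNReal.rpow_pos (ENNReal.div_pos hc hM) (ENNReal.div_ne_top hc1 hM0)).ne'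
  have hκ1 : κ ≠ ∞ := ENNReal.rpow_ne_top_of_nonneg h0.le (ENNReal.div_ne_top hc1 hM0)
  set B := Metric.closedBall x (σ * r)
  have hB0 : μ B ≠ 0 := (Metric.measure_closedBall_pos μ _ (mul_pos h0 hr)).ne'
  have hB1 : μ B ≠ ∞ := measure_closedBall_lt_top.ne
  have hcomp : ∀ᶠ n in atTop, ∀ y ∈ B, κ * u n x ≤ u n y ∧ κ * u n y ≤ u n x := by
    filter_upwards [hup, hlow] with n h2 h3 y hy
    exact (hu n).rpow_mul_le_of_mem_closedBall hM0 hM h2 h3 h0 h1 hy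
  have hac : (ν : Measure E) ≪ μ :=
    Measure.absolutelyContinuous_of_le_smul (limit_le_smul hνs hν hM hup)
  have hsphere : (ν : Measure E) B ≤ (ν : Measure E) (Metric.ball x (σ * r)) := by
    rw [show B = Metric.ball x (σ * r) ∪ Metric.sphere x (σ * r) from
      Metric.ball_union_sphere.symm]
    refine (measure_union_le _ _).trans ?_
    rw [hac (Measure.addHaar_sphere_of_ne_zero μ x (mul_pos h0 hr).ne'), add_zero]
  have e1 : κ * μ B * limsup (fun n => u n x) atTop ≤ (ν : Measure E) B := by
    rw [← ENNReal.limsup_const_mul_of_ne_top (ENNReal.mul_ne_top hκ1 hB1)]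
    refine le_trans (limsup_le_limsup ?_)
      (ProbabilityMeasure.limsup_measure_closed_le_of_tendsto hν Metric.isClosed_closedBall)
    filter_upwards [hcomp] with n hn
    rw [hνs n, withDensity_apply _ Metric.isClosed_closedBall.measurableSet,
      mul_right_comm, ← setLIntegral_const]
    exact setLIntegral_mono' Metric.isClosed_closedBall.measurableSet fun y hy => (hn y hy).1
  have e2 : κ * (ν : Measure E) (Metric.ball x (σ * r)) ≤
      μ B * liminf (fun n => u n x) atTop := by
    rw [← ENNReal.liminf_const_mul_of_ne_top hB1]
    refine (mul_le_mul_right (ProbabilityMeasure.le_liminf_measure_open_of_tendsto hν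
      Metric.isOpen_ball) _).trans ?_
    rw [← ENNReal.liminf_const_mul_of_ne_top hκ1]
    refine liminf_le_liminf ?_
    filter_upwards [hcomp] with n hn
    refine (mul_le_mul_right (measure_mono Metric.ball_subset_closedBall) _).trans ?_
    rw [hνs n, withDensity_apply _ Metric.isClosed_closedBall.measurableSet,
      ← lintegral_const_mul' _ _ hκ1, mul_comm (μ _), ← setLIntegral_const]
    exact setLIntegral_mono' Metric.isClosed_closedBall.measurableSet fun y hy => (hn y hy).2
  refine (ENNReal.mul_le_mul_iff_right hB0 hB1).1 ?_
  calc μ B * (κ ^ 2 * limsup (fun n => u n x) atTop)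
      = κ * (κ * μ B * limsup (fun n => u n x) atTop) := by ring
    _ ≤ κ * (ν : Measure E) (Metric.ball x (σ * r)) := by gcongr; exact e1.trans hsphere
    _ ≤ _ := e2

/-- The point `q` near `y` with large value varies with `n`, but if it stays within `τ * R` of `y`,
every cone from `q` contains the fixed point `(1 - τ) • y + τ • z`. -/
theorem support_subset_closure_posSet (hu : ∀ n, LogConcave (u n))
    (hνs : ∀ n, (νs n : Measure E) = μ.withDensity (u n)) (hν : Tendsto νs atTop (𝓝 ν))
    {z : E} {R : ℝ} (hR : 0 < R) {c : ℝ≥0∞} (hc : c ≠ 0)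
    (hlow : ∀ᶠ n in atTop, ∀ y ∈ Metric.closedBall z R, c ≤ u n y) :
    (ν : Measure E).support ⊆ closure (posSet u) := by
  intro y hy
  have h1 : Tendsto (fun τ : ℝ => (1 - τ) • y + τ • z) (𝓝[>] 0) (𝓝 y) :=
    (Continuous.tendsto' (by fun_prop) _ _ (by simp)).mono_left nhdsWithin_le_nhds
  refine mem_closure_of_tendsto h1 ?_
  filter_upwards [Ioo_mem_nhdsGT (zero_lt_one' ℝ)] with τ hτ
  obtain ⟨c', hc', h⟩ := exists_eventually_le_of_mem_support hνs hν hy (mul_pos hτ.1 hR)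
  refine mem_posSet_of_eventually_le (c := min c c') (lt_min (pos_iff_ne_zero.2 hc)
    (pos_iff_ne_zero.2 hc')).ne' ?_
  filter_upwards [hlow, h] with n hn hn'
  obtain ⟨q, hq, hcq⟩ := hn'
  refine (hu n).le_of_mem_cone (q := q) (fun y hy => (min_le_left _ _).trans (hn y hy))
    ((min_le_right _ _).trans hcq) hτ.1 hτ.2.le ?_
  have e : (1 - τ) • y + τ • z - ((1 - τ) • q + τ • z) = (1 - τ) • (y - q) := by
    rw [smul_sub]; abel
  rw [e, norm_smul, Real.norm_eq_abs, abs_of_pos (by linarith [hτ.2]), ← dist_eq_norm, dist_comm]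
  have := Metric.mem_closedBall.1 hq
  nlinarith [hτ.1, hτ.2, dist_nonneg (x := q) (y := y)]

theorem ae_notMem_frontier_posSet (μ : Measure E) [μ.IsAddHaarMeasure]
    (hu : ∀ n, LogConcave (u n)) : ∀ᵐ x ∂μ, x ∉ frontier (posSet u) :=
  measure_eq_zero_iff_ae_notMem.1 ((convex_posSet hu).addHaar_frontier μ)

/-- A weak limit of log-concave distributions whose support is full-dimensional has density the
pointwise lower limit of the densities. -/
theorem limit_eq_withDensity_liminf (hu : ∀ n, LogConcave (u n)) (hum : ∀ n, Measurable (u n))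
    (hνs : ∀ n, (νs n : Measure E) = μ.withDensity (u n)) (hν : Tendsto νs atTop (𝓝 ν))
    (hfull : affineSpan ℝ (ν : Measure E).support = ⊤) :
    (ν : Measure E) = μ.withDensity (fun x => liminf (fun n => u n x) atTop) ∧
    (∀ x, usc (fun x => liminf (fun n => u n x) atTop) x ≠ ∞) ∧
    usc (fun x => liminf (fun n => u n x) atTop) =ᵐ[μ] fun x => liminf (fun n => u n x) atTop := by
  obtain ⟨z, R, hR, c, M, hc, hM0, hM, hlow, hup⟩ := exists_ball_bounds hu hνs hν hfull
  set g : E → ℝ≥0∞ := fun x => liminf (fun n => u n x) atTop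
  have hgm : Measurable g := Measurable.liminf hum
  have hgM : ∀ x, g x ≤ M := by
    intro x
    refine liminf_le_of_le (by isBoundedDefault) fun b hb => ?_
    obtain ⟨n, h1, h2⟩ := (hb.and hup).exists
    exact h1.trans (h2 x)
  have hlocal : ∀ x ∈ interior (posSet u), ∃ r : ℝ, 0 < r ∧ ∃ c' : ℝ≥0∞, c' ≠ 0 ∧ c' ≠ ∞ ∧
      ∀ᶠ n in atTop, ∀ y ∈ Metric.closedBall x r, c' ≤ u n y := by
    intro x hx
    obtain ⟨r, hr, c', hc', h⟩ := exists_closedBall_lower_bound_of_mem_interior hu hR hc hlow hx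
    obtain ⟨n, h1, h2⟩ := (h.and hup).exists
    exact ⟨r, hr, c', hc', ne_top_of_le_ne_top hM
      ((h1 x (Metric.mem_closedBall_self hr.le)).trans (h2 x)), h⟩
  have hout : ∀ x, x ∉ closure (posSet u) → limsup (fun n => u n x) atTop = 0 := by
    intro x hx
    by_contra h
    exact hx (support_subset_closure_posSet hu hνs hν hR hc hlow
      (mem_support_of_limsup_pos hu hνs hν hR hc hlow (pos_iff_ne_zero.2 h)))
  have hlim : ∀ᵐ x ∂μ, Tendsto (fun n => u n x) atTop (𝓝 (g x)) := by
    filter_upwards [ae_notMem_frontier_posSet μ hu] with x hx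
    refine tendsto_of_le_liminf_of_limsup_le le_rfl ?_
    by_cases hxc : x ∈ closure (posSet u)
    · have hxi : x ∈ interior (posSet u) := by
        by_contra h
        exact hx ⟨hxc, h⟩
      obtain ⟨r, hr, c', hc', hc1, h⟩ := hlocal x hxi
      exact limsup_le_liminf_of_mem_interior hu hνs hν hM0 hM hup hr hc' hc1 h
    · rw [hout x hxc]
      exact zero_le
  have hg1 : μ.withDensity g univ ≤ 1 := by
    rw [withDensity_apply _ MeasurableSet.univ]
    refine (lintegral_liminf_le hum).trans ?_
    refine liminf_le_of_le (by isBoundedDefault) fun b hb => ?_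
    obtain ⟨n, h1⟩ := hb.exists
    refine h1.trans ?_
    rw [← withDensity_apply _ MeasurableSet.univ, ← hνs n, measure_univ]
  have hfin : IsFiniteMeasure (μ.withDensity g) := ⟨hg1.trans_lt ENNReal.one_lt_top⟩
  have hbdd : ∀ O : Set E, IsOpen O → μ O ≠ ∞ → (ν : Measure E) O ≤ μ.withDensity g O := by
    intro O hO hO1
    refine (ProbabilityMeasure.le_liminf_measure_open_of_tendsto hν hO).trans ?_
    rw [withDensity_apply _ hO.measurableSet]
    -- The bound by `M` holds only eventually; truncation makes it hold for all `n`.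
    have hd : Tendsto (fun n => ∫⁻ x in O, min (u n x) M ∂μ) atTop (𝓝 (∫⁻ x in O, g x ∂μ)) := by
      refine tendsto_lintegral_of_dominated_convergence (fun _ => M)
        (fun n => (hum n).min measurable_const) (fun n => ae_of_all _ fun x => min_le_right _ _) ?_ ?_
      · rw [setLIntegral_const]
        exact ENNReal.mul_ne_top hM hO1
      · filter_upwards [ae_restrict_of_ae hlim] with x hx
        refine hx.congr' ?_
        filter_upwards [hup] with n hn
        exact (min_eq_left (hn x)).symm
    rw [← hd.liminf_eq]
    refine liminf_le_liminf ?_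
    filter_upwards [hup] with n hn
    rw [hνs n, withDensity_apply _ hO.measurableSet]
    exact lintegral_mono fun x => le_min le_rfl (hn x)
  have hopen : ∀ O : Set E, IsOpen O → (ν : Measure E) O ≤ μ.withDensity g O := by
    intro O hO
    have hU : O = ⋃ n : ℕ, O ∩ Metric.ball 0 n := by
      rw [← inter_iUnion, Metric.iUnion_ball_nat, inter_univ]
    have hmono : Monotone fun n : ℕ => O ∩ Metric.ball (0 : E) n := fun m n h =>
      inter_subset_inter_right _ (Metric.ball_subset_ball (by exact_mod_cast h))
    have e : (ν : Measure E) O = ⨆ n : ℕ, (ν : Measure E) (O ∩ Metric.ball 0 n) := by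
      conv_lhs => rw [hU]
      exact hmono.measure_iUnion
    rw [e]
    refine iSup_le fun n => ?_
    exact (hbdd _ (hO.inter Metric.isOpen_ball) (measure_ne_top_of_subset inter_subset_right
      measure_ball_lt_top.ne)).trans (measure_mono inter_subset_left)
  have hle : (ν : Measure E) ≤ μ.withDensity g := Measure.le_of_forall_isOpen_le hopen
  -- The probability measure `ν` lies below a measure whose mass is at most `1` by Fatou, so the two
  -- coincide.
  refine ⟨Measure.eq_of_le_of_measure_univ_eq hle ?_, fun x => ?_, ?_⟩
  · exact le_antisymm (hle univ) (hg1.trans_eq measure_univ.symm)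
  · exact ne_top_of_le_ne_top hM (usc_le_of_eventually_le (Eventually.of_forall hgM))
  · filter_upwards [ae_notMem_frontier_posSet μ hu] with x hx
    refine le_antisymm ?_ (le_usc g x)
    by_cases hxc : x ∈ closure (posSet u)
    · have hxi : x ∈ interior (posSet u) := by
        by_contra h
        exact hx ⟨hxc, h⟩
      obtain ⟨r, hr, c', hc', hc1, h⟩ := hlocal x hxi
      have hρ0 : c' / M ≠ 0 := (ENNReal.div_pos hc' hM).ne'
      have hρ1 : c' / M ≠ ∞ := ENNReal.div_ne_top hc1 hM0
      refine ENNReal.le_of_forall_rpow_mul_le hρ0 hρ1 fun σ h0 h1 => ?_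
      have hκ1 : (c' / M) ^ σ ≠ ∞ := ENNReal.rpow_ne_top_of_nonneg h0.le hρ1
      rw [usc, ← ENNReal.limsup_const_mul_of_ne_top hκ1]
      refine limsup_le_of_le (by isBoundedDefault) ?_
      filter_upwards [Metric.closedBall_mem_nhds x (mul_pos h0 hr)] with y hy
      rw [← ENNReal.liminf_const_mul_of_ne_top hκ1]
      refine liminf_le_liminf ?_
      filter_upwards [hup, h] with n h2 h3
      exact ((hu n).rpow_mul_le_of_mem_closedBall hM0 hM h2 h3 h0 h1 hy).2
    · refine (usc_le_of_eventually_le (c := 0) ?_).trans zero_le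
      filter_upwards [isClosed_closure.isOpen_compl.mem_nhds hxc] with y hy
      exact (liminf_le_limsup (by isBoundedDefault) (by isBoundedDefault)).trans (hout y hy).le

end

variable [FiniteDimensional ℝ E]

theorem affineSpan_support_eq_top_of_absolutelyContinuous {μ : Measure E} [μ.IsAddHaarMeasure]
    {ν : Measure E} [IsProbabilityMeasure ν] (h : ν ≪ μ) : affineSpan ℝ ν.support = ⊤ := by
  by_contra hne
  have h0 := h (Measure.addHaar_affineSubspace μ _ hne)
  have h1 : ν univ ≤ 0 := by
    rw [← union_compl_self ν.support]
    refine (measure_union_le _ _).trans ?_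
    rw [Measure.measure_compl_support, add_zero, ← h0]
    exact measure_mono (subset_affineSpan ℝ _)
  simp at h1

/-- The limit theorem for a constant sequence. -/
theorem usc_ae_eq_of_logConcave {μ : Measure E} [μ.IsAddHaarMeasure] {u : E → ℝ≥0∞}
    (hu : LogConcave u) (hum : Measurable u) [hP : IsProbabilityMeasure (μ.withDensity u)] :
    usc u =ᵐ[μ] u := by
  have := (limit_eq_withDensity_liminf (μ := μ) (u := fun _ => u)
    (νs := fun _ => ⟨μ.withDensity u, hP⟩) (ν := ⟨μ.withDensity u, hP⟩) (fun _ => hu) (fun _ => hum)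
    (fun _ => rfl) tendsto_const_nhds
    (affineSpan_support_eq_top_of_absolutelyContinuous (ν := μ.withDensity u)
      (withDensity_absolutelyContinuous μ u))).2.2
  simpa only [liminf_const] using this

theorem limit_eq_withDensity_usc_liminf_usc {μ : Measure E} [μ.IsAddHaarMeasure]
    {u : ℕ → E → ℝ≥0∞} {νs : ℕ → ProbabilityMeasure E} {ν : ProbabilityMeasure E}
    (hu : ∀ n, LogConcave (u n)) (hum : ∀ n, Measurable (u n))
    (hνs : ∀ n, (νs n : Measure E) = μ.withDensity (u n)) (hν : Tendsto νs atTop (𝓝 ν))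
    (hfull : affineSpan ℝ (ν : Measure E).support = ⊤) :
    (ν : Measure E) = μ.withDensity (usc fun x => liminf (fun n => usc (u n) x) atTop) ∧
    ∀ x, usc (fun x => liminf (fun n => usc (u n) x) atTop) x ≠ ∞ := by
  have hνs' : ∀ n, (νs n : Measure E) = μ.withDensity (usc (u n)) := by
    intro n
    have : IsProbabilityMeasure (μ.withDensity (u n)) := by rw [← hνs n]; infer_instance
    rw [hνs n]
    exact withDensity_congr_ae (usc_ae_eq_of_logConcave (hu n) (hum n)).symm
  obtain ⟨h1, h2, h3⟩ := limit_eq_withDensity_liminf (fun n => (hu n).usc)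
    (fun n => (upperSemicontinuous_usc (u n)).measurable) hνs' hν hfull
  exact ⟨h1.trans (withDensity_congr_ae h3.symm), h2⟩

end

/-! ### Marginals and the reduction to the affine hull of the convex support. -/

section
variable {d : ℕ}

theorem IsLogConcaveDensity.logConcave_univ {μ : Measure (EuclideanSpace ℝ (Fin d))}
    {f : EuclideanSpace ℝ (Fin d) → ℝ≥0∞} (hf : IsLogConcaveDensity univ μ f) : LogConcave f :=
  fun x y => hf.logConcave x (mem_univ x) y (mem_univ y)

theorem IsLogConcaveDensity.measurable {μ : Measure (EuclideanSpace ℝ (Fin d))}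
    {f : EuclideanSpace ℝ (Fin d) → ℝ≥0∞} (hf : IsLogConcaveDensity univ μ f) : Measurable f :=
  (upperSemicontinuousOn_univ_iff.1 hf.upperSemicontinuousOn).measurable

theorem upperSemicontinuousOn_clOn (A : Set (EuclideanSpace ℝ (Fin d)))
    (g : EuclideanSpace ℝ (Fin d) → ℝ≥0∞) : UpperSemicontinuousOn (clOn A g) A := by
  intro x _ c hc
  obtain ⟨c', hc', hcc⟩ := exists_between hc
  have h : ∀ᶠ y in 𝓝[A] x, g y < c' := eventually_lt_of_limsup_lt hc'
  filter_upwards [eventually_eventually_nhdsWithin.2 h] with y hy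
  exact (limsup_le_of_le (by isBoundedDefault) (hy.mono fun _ h => h.le)).trans_lt hcc

theorem clOn_range_apply {F : Type*} [TopologicalSpace F] {ι : F → EuclideanSpace ℝ (Fin d)}
    (hι : IsEmbedding ι) (g : EuclideanSpace ℝ (Fin d) → ℝ≥0∞) (x : F) :
    clOn (range ι) g (ι x) = usc (fun y => g (ι y)) x := by
  rw [clOn, ← hι.map_nhds_eq]
  rfl

theorem MeasurableEmbedding.map_withDensity_comp {X Y : Type*} [MeasurableSpace X]
    [MeasurableSpace Y] {ι : X → Y} (hι : MeasurableEmbedding ι) (μ : Measure X) (F : Y → ℝ≥0∞) :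
    (μ.withDensity fun x => F (ι x)).map ι = (μ.map ι).withDensity F := by
  ext s hs
  rw [hι.map_apply, withDensity_apply _ (hι.measurable hs), withDensity_apply _ hs,
    hι.restrict_map, hι.lintegral_map]

section
variable (U : Submodule ℝ (EuclideanSpace ℝ (Fin d)))

/-- An isometric parametrization of a subspace. -/
noncomputable def subIso : EuclideanSpace ℝ (Fin (Module.finrank ℝ U)) ≃ₗᵢ[ℝ] U :=
  (stdOrthonormalBasis ℝ U).repr.symm

theorem measurePreserving_subIso : MeasurePreserving (subIso U) volume (lebesgueSub U) :=
  (subIso U).measurePreserving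

/-- Orthogonal projection to a subspace, read in an isometric parametrization. -/
noncomputable def subProj :
    EuclideanSpace ℝ (Fin d) →L[ℝ] EuclideanSpace ℝ (Fin (Module.finrank ℝ U)) :=
  ((subIso U).symm.toContinuousLinearEquiv : U →L[ℝ] _).comp U.orthogonalProjectionOnto

theorem subProj_add (x : EuclideanSpace ℝ (Fin (Module.finrank ℝ U))) (w : Uᗮ) :
    subProj U ((subIso U x : EuclideanSpace ℝ (Fin d)) + w) = x := by
  rw [map_add]
  simp [subProj]

theorem subIso_subProj {v : EuclideanSpace ℝ (Fin d)} (hv : v ∈ U) :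
    (subIso U (subProj U v) : EuclideanSpace ℝ (Fin d)) = v := by
  simp only [subProj, ContinuousLinearMap.comp_apply]
  simp [Submodule.starProjection_eq_self_iff.2 hv]

theorem measurePreserving_subIso_add (a : EuclideanSpace ℝ (Fin d)) :
    MeasurePreserving (fun p : EuclideanSpace ℝ (Fin (Module.finrank ℝ U)) ×
      EuclideanSpace ℝ (Fin (Module.finrank ℝ Uᗮ)) =>
      (subIso U p.1 : EuclideanSpace ℝ (Fin d)) + a + (subIso Uᗮ p.2 : Uᗮ)) volume volume := by
  have h1 := (((LinearIsometryEquiv.withLpProdCongr 2 (subIso U) (subIso Uᗮ)).trans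
    U.orthogonalDecomposition.symm).measurePreserving).comp (WithLp.volume_preserving_toLp
      (EuclideanSpace ℝ (Fin (Module.finrank ℝ U))) (EuclideanSpace ℝ (Fin (Module.finrank ℝ Uᗮ))))
  have h2 := (measurePreserving_add_right volume a).comp h1
  refine (congrArg (fun g => MeasurePreserving g volume volume) (funext fun p => ?_)).mpr h2
  have h3 : (subIso U p.1 : EuclideanSpace ℝ (Fin d)) + a + (subIso Uᗮ p.2 : Uᗮ) =
      (subIso U p.1 : EuclideanSpace ℝ (Fin d)) + (subIso Uᗮ p.2 : Uᗮ) + a := by abel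
  exact h3

/-- The marginal of `f` on `U + a`, in the coordinates of `U`. -/
noncomputable def marginal (f : EuclideanSpace ℝ (Fin d) → ℝ≥0∞) (a : EuclideanSpace ℝ (Fin d))
    (x : EuclideanSpace ℝ (Fin (Module.finrank ℝ U))) : ℝ≥0∞ :=
  ∫⁻ w, f ((subIso U x : EuclideanSpace ℝ (Fin d)) + a + (w : EuclideanSpace ℝ (Fin d)))
    ∂(lebesgueSub Uᗮ)

variable {f : EuclideanSpace ℝ (Fin d) → ℝ≥0∞}

theorem marginal_eq (hf : Measurable f) (a : EuclideanSpace ℝ (Fin d))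
    (x : EuclideanSpace ℝ (Fin (Module.finrank ℝ U))) :
    marginal U f a x = ∫⁻ w, f ((subIso U x : EuclideanSpace ℝ (Fin d)) + a + (subIso Uᗮ w : Uᗮ)) :=
  ((measurePreserving_subIso Uᗮ).lintegral_comp
    (f := fun w : Uᗮ => f ((subIso U x : EuclideanSpace ℝ (Fin d)) + a + w)) (by fun_prop)).symm

theorem measurable_marginal (hf : Measurable f) (a : EuclideanSpace ℝ (Fin d)) :
    Measurable (marginal U f a) := by
  simp_rw [funext (marginal_eq U hf a)]
  exact (hf.comp (measurePreserving_subIso_add U a).measurable).lintegral_prod_right'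

theorem logConcave_marginal (hf : Measurable f) (hlc : LogConcave f)
    (a : EuclideanSpace ℝ (Fin d)) : LogConcave (marginal U f a) := by
  have h : marginal U f a = fun x => ∫⁻ w : Fin (Module.finrank ℝ Uᗮ) → ℝ,
      f ((subIso U x : EuclideanSpace ℝ (Fin d)) + a + (subIso Uᗮ (WithLp.toLp 2 w) : Uᗮ)) := by
    funext x
    rw [marginal_eq U hf]
    exact ((PiLp.volume_preserving_toLp (Fin (Module.finrank ℝ Uᗮ))).lintegral_comp
      (f := fun w => f ((subIso U x : EuclideanSpace ℝ (Fin d)) + a + (subIso Uᗮ w : Uᗮ)))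
      (hf.comp ((measurable_const_add _).comp
        (measurable_subtype_coe.comp (subIso Uᗮ).continuous.measurable)))).symm
  rw [h]
  refine LogConcave.lintegral_pi _
    (u := fun p : EuclideanSpace ℝ (Fin (Module.finrank ℝ U)) × (Fin (Module.finrank ℝ Uᗮ) → ℝ) =>
      f ((subIso U p.1 : EuclideanSpace ℝ (Fin d)) + a + (subIso Uᗮ (WithLp.toLp 2 p.2) : Uᗮ)))
    (hlc.comp fun x y s t hst => ?_) fun x => ?_
  · have ha : a = s • a + t • a := by rw [← add_smul, hst, one_smul]
    conv_lhs => rw [ha]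
    simp only [Prod.fst_add, Prod.snd_add, Prod.smul_fst, Prod.smul_snd, WithLp.toLp_add,
      WithLp.toLp_smul, map_add, map_smul, Submodule.coe_add, Submodule.coe_smul, smul_add]
    abel
  · exact hf.comp ((measurable_const_add ((subIso U x : EuclideanSpace ℝ (Fin d)) + a)).comp
      (measurable_subtype_coe.comp ((subIso Uᗮ).continuous.measurable.comp (WithLp.measurable_toLp 2 _))))

/-- Tonelli in `U ⊕ Uᗮ`, where the preimage of `s` is the cylinder `s ×ˢ univ`. -/
theorem map_subProj_withDensity (hf : Measurable f) (a : EuclideanSpace ℝ (Fin d)) :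
    (volume.withDensity f).map (fun y => subProj U (y - a)) =
      volume.withDensity (marginal U f a) := by
  have hmeas : Measurable fun y : EuclideanSpace ℝ (Fin d) => subProj U (y - a) := by fun_prop
  have hmp := measurePreserving_subIso_add U a
  ext s hs
  rw [Measure.map_apply hmeas hs, withDensity_apply _ (hmeas hs), withDensity_apply _ hs,
    ← hmp.setLIntegral_comp_preimage (hmeas hs) hf]
  have hpre : (fun p : EuclideanSpace ℝ (Fin (Module.finrank ℝ U)) ×
      EuclideanSpace ℝ (Fin (Module.finrank ℝ Uᗮ)) =>
      (subIso U p.1 : EuclideanSpace ℝ (Fin d)) + a + (subIso Uᗮ p.2 : Uᗮ)) ⁻¹'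
      ((fun y : EuclideanSpace ℝ (Fin d) => subProj U (y - a)) ⁻¹' s) = s ×ˢ univ := by
    ext p
    have : (subIso U p.1 : EuclideanSpace ℝ (Fin d)) + a + (subIso Uᗮ p.2 : Uᗮ) - a =
      (subIso U p.1 : EuclideanSpace ℝ (Fin d)) + (subIso Uᗮ p.2 : Uᗮ) := by abel
    simp only [mem_preimage, this, subProj_add, mem_prod, mem_univ, and_true]
  rw [hpre, Measure.volume_eq_prod, ← Measure.prod_restrict, Measure.restrict_univ]
  refine (lintegral_prod _ (hf.comp hmp.measurable).aemeasurable).trans ?_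
  simp_rw [marginal_eq U hf a]
  rfl

end

theorem measure_eq_one_of_csupp_subset {ν : Measure (EuclideanSpace ℝ (Fin d))}
    [IsProbabilityMeasure ν] {S : Set (EuclideanSpace ℝ (Fin d))} (h : csupp ν ⊆ S) : ν S = 1 :=
  le_antisymm prob_le_one ((isLeast_csupp ν).1.2.2.symm.le.trans (measure_mono h))

theorem csupp_subset_of_support_subset {ν : Measure (EuclideanSpace ℝ (Fin d))}
    [IsProbabilityMeasure ν] {H : AffineSubspace ℝ (EuclideanSpace ℝ (Fin d))}
    (h : ν.support ⊆ H) : csupp ν ⊆ H := by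
  refine (isLeast_csupp ν).2 ⟨H.closed_of_finiteDimensional, H.convex, ?_⟩
  exact prob_compl_eq_zero_iff H.closed_of_finiteDimensional.measurableSet |>.1
    (measure_mono_null (compl_subset_compl.2 h) Measure.measure_compl_support)

/-- A weak limit `ν` of log-concave distributions has a log-concave density with respect to
Lebesgue measure on the affine hull of its convex support. -/
theorem limit_density_on_affineSpan_csupp {f : ℕ → EuclideanSpace ℝ (Fin d) → ℝ≥0∞}
    (hf : ∀ n, IsLogConcaveDensity univ volume (f n))
    {νs : ℕ → ProbabilityMeasure (EuclideanSpace ℝ (Fin d))}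
    (hνs : ∀ n, (νs n : Measure (EuclideanSpace ℝ (Fin d))) = volume.withDensity (f n))
    {ν : ProbabilityMeasure (EuclideanSpace ℝ (Fin d))} (hν : Tendsto νs atTop (𝓝 ν))
    {A : AffineSubspace ℝ (EuclideanSpace ℝ (Fin d))}
    (hA : A = affineSpan ℝ (csupp (ν : Measure (EuclideanSpace ℝ (Fin d))))) :
    (ν : Measure (EuclideanSpace ℝ (Fin d))) = (lebesgueOn A).withDensity
        (clOn A (fun x => liminf (fun n => marginalOn A (f n) x) atTop)) ∧
      IsLogConcaveDensity A (lebesgueOn A)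
        (clOn A (fun x => liminf (fun n => marginalOn A (f n) x) atTop)) := by
  have hsub : csupp (ν : Measure (EuclideanSpace ℝ (Fin d))) ⊆ A := hA ▸ subset_affineSpan ℝ _
  have hνA := measure_eq_one_of_csupp_subset hsub
  obtain ⟨a, ha⟩ : (A : Set (EuclideanSpace ℝ (Fin d))).Nonempty :=
    nonempty_of_measure_ne_zero (hνA ▸ one_ne_zero)
  set U := A.direction with hU
  set ι : EuclideanSpace ℝ (Fin (Module.finrank ℝ U)) → EuclideanSpace ℝ (Fin d) :=
    fun x => (subIso U x : EuclideanSpace ℝ (Fin d)) + a with hι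
  set π : EuclideanSpace ℝ (Fin d) → EuclideanSpace ℝ (Fin (Module.finrank ℝ U)) :=
    fun y => subProj U (y - a) with hπ
  have hπc : Continuous π := by fun_prop
  have hιc : Continuous ι :=
    (continuous_subtype_val.comp (subIso U).continuous).add continuous_const
  have hπι : ∀ x, π (ι x) = x := by
    intro x
    have := subProj_add U x 0
    simpa [hπ, hι] using this
  have hιπ : ∀ y ∈ A, ι (π y) = y := by
    intro y hy
    have := subIso_subProj U (AffineSubspace.vsub_mem_direction hy ha)
    simp only [hπ, hι]
    rw [vsub_eq_sub] at this
    rw [this, sub_add_cancel]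
  have hιA : ∀ x, ι x ∈ A := fun x =>
    AffineSubspace.vadd_mem_of_mem_direction (subIso U x).2 ha
  have hrange : (A : Set (EuclideanSpace ℝ (Fin d))) = range ι := by
    ext y
    exact ⟨fun hy => ⟨π y, hιπ y hy⟩, by rintro ⟨x, rfl⟩; exact hιA x⟩
  have hemb : IsClosedEmbedding ι :=
    .of_continuous_injective_isClosedMap hιc (Function.LeftInverse.injective hπι)
      fun K hK => by
        have : ι '' K = (A : Set (EuclideanSpace ℝ (Fin d))) ∩ π ⁻¹' K := by
          ext y
          constructor
          · rintro ⟨x, hx, rfl⟩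
            exact ⟨hιA x, by rwa [mem_preimage, hπι]⟩
          · rintro ⟨hy, hyK⟩
            exact ⟨π y, hyK, hιπ y hy⟩
        rw [this]
        exact A.closed_of_finiteDimensional.inter (hK.preimage hπc)
  have hιlin : ∀ x y : EuclideanSpace ℝ (Fin (Module.finrank ℝ U)), ∀ s t : ℝ, s + t = 1 →
      ι (s • x + t • y) = s • ι x + t • ι y := by
    intro x y s t hst
    have ha : a = s • a + t • a := by rw [← add_smul, hst, one_smul]
    simp only [hι]
    conv_lhs => rw [ha]
    simp only [map_add, map_smul, Submodule.coe_add, Submodule.coe_smul, smul_add]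
    abel
  have hleb : lebesgueOn A = (volume : Measure _).map ι := by
    rw [lebesgueOn_eq A ha, ← (measurePreserving_subIso A.direction).map_eq,
      Measure.map_map (by fun_prop) (subIso U).continuous.measurable]
    rfl
  set u : ℕ → EuclideanSpace ℝ (Fin (Module.finrank ℝ U)) → ℝ≥0∞ := fun n => marginal U (f n) a
  have hmarg : ∀ n x, marginalOn A (f n) (ι x) = usc (u n) x := by
    intro n x
    rw [marginalOn, hrange, clOn_range_apply hemb.isEmbedding]
    rfl
  set G := usc fun x => liminf (fun n => usc (u n) x) atTop
  set F := clOn A (fun x => liminf (fun n => marginalOn A (f n) x) atTop)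
  have hF : ∀ x, F (ι x) = G x := by
    intro x
    simp only [F, G]
    rw [hrange, clOn_range_apply hemb.isEmbedding]
    simp_rw [hmarg]
  have hπm : AEMeasurable π (ν : Measure (EuclideanSpace ℝ (Fin d))) := hπc.measurable.aemeasurable
  have hlim : Tendsto (fun n => (νs n).map hπc.measurable.aemeasurable) atTop (𝓝 (ν.map hπm)) :=
    ProbabilityMeasure.tendsto_map_of_tendsto_of_continuous νs ν hν hπc
  have hmapn : ∀ n, (((νs n).map hπc.measurable.aemeasurable : ProbabilityMeasure _) : Measure _) =
      volume.withDensity (u n) := by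
    intro n
    rw [ProbabilityMeasure.toMeasure_map, hνs n]
    exact map_subProj_withDensity U (hf n).measurable a
  -- The span `H` of the projected support pulls back to a closed convex set of full `ν`-measure.
  -- That set contains `csupp ν`, hence `A`, and `π` maps `A` onto the whole coordinate space.
  have hfull : affineSpan ℝ ((ν.map hπm : ProbabilityMeasure (EuclideanSpace ℝ (Fin (Module.finrank ℝ U)))) :
      Measure (EuclideanSpace ℝ (Fin (Module.finrank ℝ U)))).support = ⊤ := by
    set ν' := ((ν.map hπm : ProbabilityMeasure _) :
      Measure (EuclideanSpace ℝ (Fin (Module.finrank ℝ U))))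
    set H := affineSpan ℝ ν'.support
    have hHc : IsClosed (H : Set (EuclideanSpace ℝ (Fin (Module.finrank ℝ U)))) :=
      H.closed_of_finiteDimensional
    set πa : EuclideanSpace ℝ (Fin d) →ᵃ[ℝ] EuclideanSpace ℝ (Fin (Module.finrank ℝ U)) :=
      (subProj U : EuclideanSpace ℝ (Fin d) →ₗ[ℝ] _).toAffineMap -
        AffineMap.const ℝ _ (subProj U a)
    have hπa : ∀ y, πa y = π y := fun y => by simp [πa, hπ]
    have hHcomap : ((H.comap πa : AffineSubspace ℝ _) : Set (EuclideanSpace ℝ (Fin d))) =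
        π ⁻¹' H := by
      ext y
      simp [hπa]
    have hν'H : ν' (H : Set _)ᶜ = 0 :=
      measure_mono_null (compl_subset_compl.2 (subset_affineSpan ℝ _)) Measure.measure_compl_support
    have h1 : csupp (ν : Measure (EuclideanSpace ℝ (Fin d))) ⊆ H.comap πa := by
      refine (isLeast_csupp _).2 ⟨(H.comap πa).closed_of_finiteDimensional, (H.comap πa).convex, ?_⟩
      rw [hHcomap, ← prob_compl_eq_zero_iff (hHc.preimage hπc).measurableSet, ← preimage_compl,
        ← Measure.map_apply hπc.measurable hHc.measurableSet.compl]
      exact hν'H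
    have h2 : A ≤ H.comap πa := by
      rw [hA]
      exact affineSpan_le.2 h1
    refine eq_top_iff.2 fun x _ => ?_
    have := h2 (hιA x)
    rwa [AffineSubspace.mem_comap, hπa, hπι] at this
  obtain ⟨hden, htop⟩ := limit_eq_withDensity_usc_liminf_usc (μ := volume)
    (fun n => logConcave_marginal U (hf n).measurable (hf n).logConcave_univ a)
    (fun n => measurable_marginal U (hf n).measurable a) hmapn hlim hfull
  have hνeq : (ν : Measure (EuclideanSpace ℝ (Fin d))) = (lebesgueOn A).withDensity F := by
    -- No mass is lost by projecting: `ν` is carried by `A`, where `ι ∘ π` is the identity.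
    have e1 : ((ν.map hπm : ProbabilityMeasure (EuclideanSpace ℝ (Fin (Module.finrank ℝ U)))) :
      Measure (EuclideanSpace ℝ (Fin (Module.finrank ℝ U)))).map ι =
        (ν : Measure (EuclideanSpace ℝ (Fin d))) := by
      rw [ProbabilityMeasure.toMeasure_map, Measure.map_map hιc.measurable hπc.measurable]
      conv_rhs => rw [← Measure.map_id (μ := (ν : Measure (EuclideanSpace ℝ (Fin d))))]
      refine Measure.map_congr ?_
      have hae : ∀ᵐ y ∂(ν : Measure (EuclideanSpace ℝ (Fin d))),
          y ∈ (A : Set (EuclideanSpace ℝ (Fin d))) :=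
        (mem_ae_iff_prob_eq_one A.closed_of_finiteDimensional.measurableSet).2 hνA
      filter_upwards [hae] with y hy using hιπ y hy
    rw [← e1, hden, hleb, ← hemb.measurableEmbedding.map_withDensity_comp]
    simp_rw [hF]
    rfl
  refine ⟨hνeq, ?_, upperSemicontinuousOn_clOn _ _, ?_, ?_⟩
  · rw [hrange]
    rintro _ ⟨x, rfl⟩
    rw [hF]
    exact htop x
  · rw [hrange]
    rintro _ ⟨x, rfl⟩ _ ⟨y, rfl⟩ s t hs ht hst
    rw [← hιlin x y s t hst, hF, hF, hF]
    exact (LogConcave.liminf (Eventually.of_forall fun n => (logConcave_marginal U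
      (hf n).measurable (hf n).logConcave_univ a).usc)).usc x y s t hs ht hst
  · rw [← setLIntegral_univ, ← withDensity_apply _ MeasurableSet.univ, ← hνeq, measure_univ]

/-! ### Positivity set of codimension one. -/

theorem affineSpan_insert_eq_top_of_convexDim {C : Set (EuclideanSpace ℝ (Fin d))}
    (hC : convexDim C = (d : ℤ) - 1) : affineSpan ℝ C ≠ ⊤ ∧
      ∀ x ∉ affineSpan ℝ C, affineSpan ℝ (insert x C) = ⊤ := by
  have hE : Module.finrank ℝ (EuclideanSpace ℝ (Fin d)) = d := finrank_euclideanSpace_fin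
  rcases C.eq_empty_or_nonempty with rfl | hne
  · have hd : d = 0 := by
      rw [convexDim, if_neg Set.not_nonempty_empty] at hC
      omega
    subst hd
    refine ⟨by simp, fun x _ => ?_⟩
    rw [insert_empty_eq]
    refine eq_top_iff.2 fun y _ => ?_
    rw [Subsingleton.elim y x]
    exact mem_affineSpan ℝ (mem_singleton x)
  · rw [convexDim, if_pos hne, ← direction_affineSpan] at hC
    refine ⟨fun h => ?_, fun x hx => ?_⟩
    · rw [h, AffineSubspace.direction_top, finrank_top, hE] at hC
      omega
    · have hlt : affineSpan ℝ C < affineSpan ℝ (insert x C) :=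
        lt_of_le_of_ne (affineSpan_mono ℝ (subset_insert x C)) fun h =>
          hx (h ▸ mem_affineSpan ℝ (mem_insert x C))
      have hdl := Submodule.finrank_lt_finrank_of_lt
        (AffineSubspace.direction_lt_of_nonempty hlt ((affineSpan_nonempty ℝ).2 hne))
      have hle := Submodule.finrank_le (affineSpan ℝ (insert x C)).direction
      rw [hE] at hle
      refine (AffineSubspace.direction_eq_top_iff_of_nonempty
        ((affineSpan_nonempty ℝ).2 (insert_nonempty x C))).1 ?_
      exact Submodule.eq_top_of_finrank_eq (by omega)

section
variable {u : ℕ → EuclideanSpace ℝ (Fin d) → ℝ≥0∞}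
    {νs : ℕ → ProbabilityMeasure (EuclideanSpace ℝ (Fin d))}
    {ν : ProbabilityMeasure (EuclideanSpace ℝ (Fin d))}

/-- The reindexing `φ` allows both the full sequence and a subsequence. -/
theorem exists_closedBall_lower_bound_of_insert_posSet {ι : Type*} {l : Filter ι} {φ : ι → ℕ}
    (hφ : Tendsto φ l atTop) (hu : ∀ n, LogConcave (u n)) {x : EuclideanSpace ℝ (Fin d)}
    (hspan : affineSpan ℝ (insert x (posSet u)) = ⊤)
    (hx : ∀ r : ℝ, 0 < r → ∃ c : ℝ≥0∞, c ≠ 0 ∧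
      ∀ᶠ i in l, ∃ q ∈ Metric.closedBall x r, c ≤ u (φ i) q) :
    ∃ z : EuclideanSpace ℝ (Fin d), ∃ R : ℝ, 0 < R ∧ ∃ c : ℝ≥0∞, c ≠ 0 ∧
      ∀ᶠ i in l, ∀ y ∈ Metric.closedBall z R, c ≤ u (φ i) y := by
  obtain ⟨t, hts, htspan, hti⟩ := exists_affineIndependent ℝ _ (insert x (posSet u))
  refine LogConcave.exists_closedBall_lower_bound (fun i => hu (φ i))
    (finite_set_of_fin_dim_affineIndependent ℝ hti) (htspan.trans hspan) fun p hp r hr => ?_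
  rcases hts hp with rfl | hpC
  · exact hx r hr
  · obtain ⟨c, hc, h⟩ := exists_eventually_le_of_mem_posSet hpC
    exact ⟨c, hc, (hφ.eventually h).mono fun i hi => ⟨p, Metric.mem_closedBall_self hr.le, hi⟩⟩

/-- A support point off the hyperplane would produce a ball inside `posSet u`, which would then span
the whole space. -/
theorem csupp_subset_affineSpan_posSet (hu : ∀ n, LogConcave (u n))
    (hνs : ∀ n, (νs n : Measure (EuclideanSpace ℝ (Fin d))) = volume.withDensity (u n))
    (hν : Tendsto νs atTop (𝓝 ν)) (hdim : convexDim (posSet u) = (d : ℤ) - 1) :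
    csupp (ν : Measure (EuclideanSpace ℝ (Fin d))) ⊆ affineSpan ℝ (posSet u) := by
  obtain ⟨hne, hins⟩ := affineSpan_insert_eq_top_of_convexDim hdim
  refine csupp_subset_of_support_subset fun x hx => ?_
  by_contra hxH
  obtain ⟨z, R, hR, c, hc, h⟩ := exists_closedBall_lower_bound_of_insert_posSet tendsto_id hu
    (hins x hxH) fun r hr => exists_eventually_le_of_mem_support hνs hν hx hr
  refine hne (affineSpan_eq_top_of_nonempty_interior ⟨z, ?_⟩)
  refine interior_mono (subset_convexHull ℝ _) (mem_interior_iff_mem_nhds.2 ?_)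
  filter_upwards [Metric.closedBall_mem_nhds z hR] with y hy
  exact mem_posSet_of_eventually_le hc (h.mono fun n hn => hn y hy)

/-- Otherwise values above some `ε` occur along a subsequence at points of `S` converging to `x₀`
off the hyperplane. Together with `posSet u` they force a uniform lower bound on a ball, along that
subsequence only, so the contradiction comes from the mass of `ν`. -/
theorem tendsto_iSup_of_disjoint_affineSpan_posSet (hu : ∀ n, LogConcave (u n))
    (hνs : ∀ n, (νs n : Measure (EuclideanSpace ℝ (Fin d))) = volume.withDensity (u n))
    (hν : Tendsto νs atTop (𝓝 ν)) (hdim : convexDim (posSet u) = (d : ℤ) - 1)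
    {S : Set (EuclideanSpace ℝ (Fin d))} (hS : IsCompact S)
    (hSd : Disjoint S (affineSpan ℝ (posSet u) : Set (EuclideanSpace ℝ (Fin d)))) :
    Tendsto (fun n => ⨆ x ∈ S, u n x) atTop (𝓝 0) := by
  obtain ⟨hne, hins⟩ := affineSpan_insert_eq_top_of_convexDim hdim
  set H := affineSpan ℝ (posSet u)
  have hHc : IsClosed (H : Set (EuclideanSpace ℝ (Fin d))) := H.closed_of_finiteDimensional
  have hνH : (ν : Measure (EuclideanSpace ℝ (Fin d))) (H : Set _)ᶜ = 0 :=
    (prob_compl_eq_zero_iff hHc.measurableSet).2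
      (measure_eq_one_of_csupp_subset (csupp_subset_affineSpan_posSet hu hνs hν hdim))
  rw [ENNReal.tendsto_nhds_zero]
  by_contra! hcon
  obtain ⟨ε, hε, hfr⟩ := hcon
  obtain ⟨φ, hφ, hφε⟩ := extraction_of_frequently_atTop hfr
  simp only [lt_iSup_iff] at hφε
  choose x hxS hxε using hφε
  obtain ⟨x₀, hx₀S, ψ, hψ, hx₀⟩ := hS.tendsto_subseq hxS
  have hφψ : Tendsto (fun k => φ (ψ k)) atTop atTop := hφ.tendsto_atTop.comp hψ.tendsto_atTop
  obtain ⟨z, R, hR, c, hc, h⟩ := exists_closedBall_lower_bound_of_insert_posSet hφψ hu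
    (hins x₀ (disjoint_left.1 hSd hx₀S)) fun r hr => ⟨ε, hε.ne', by
      filter_upwards [hx₀ (Metric.closedBall_mem_nhds x₀ hr)] with k hk
      exact ⟨_, hk, (hxε _).le⟩⟩
  -- A ball is not contained in the proper subspace `H`, so part of it lies in the `ν`-null
  -- complement.
  obtain ⟨y, hyb, hyH⟩ : ∃ y ∈ Metric.ball z R, y ∉ H := by
    by_contra! hsub
    exact hne (top_le_iff.1 ((Metric.isOpen_ball.affineSpan_eq_top
      (Metric.nonempty_ball.2 hR)).symm.le.trans (affineSpan_le.2 hsub)))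
  obtain ⟨r, hr, hrsub⟩ := Metric.nhds_basis_closedBall.mem_iff.1
    (inter_mem (Metric.isOpen_ball.mem_nhds hyb) (hHc.isOpen_compl.mem_nhds hyH))
  have h0 := ProbabilityMeasure.limsup_measure_closed_le_of_tendsto (hν.comp hφψ)
    (Metric.isClosed_closedBall (x := y) (ε := r))
  rw [measure_mono_null (fun w hw => (hrsub hw).2) hνH] at h0
  have h1 : c * volume (Metric.closedBall y r) ≤ 0 := by
    refine le_trans (le_limsup_of_frequently_le (Eventually.frequently ?_) (by isBoundedDefault)) h0
    filter_upwards [h] with k hk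
    rw [Function.comp, hνs, withDensity_apply _ Metric.isClosed_closedBall.measurableSet,
      ← setLIntegral_const]
    exact setLIntegral_mono' Metric.isClosed_closedBall.measurableSet fun w hw =>
      hk w (Metric.ball_subset_closedBall (hrsub hw).1)
  exact (mul_ne_zero hc (Metric.measure_closedBall_pos volume _ hr).ne') (le_antisymm h1 zero_le)

end

end

theorem proposition3p2 (d : ℕ)
    (f : ℕ → EuclideanSpace ℝ (Fin d) → ℝ≥0∞)
    (hf : ∀ n, IsLogConcaveDensity univ volume (f n))
    (νs : ℕ → ProbabilityMeasure (EuclideanSpace ℝ (Fin d)))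
    (hνs : ∀ n, (νs n : Measure (EuclideanSpace ℝ (Fin d))) = volume.withDensity (f n))
    (ν : ProbabilityMeasure (EuclideanSpace ℝ (Fin d)))
    (hν : Tendsto νs atTop (𝓝 ν))
    (C : Set (EuclideanSpace ℝ (Fin d)))
    (hC : C = {x | 0 < liminf (fun n => f n x) atTop})
    (A : AffineSubspace ℝ (EuclideanSpace ℝ (Fin d)))
    (hA : A = affineSpan ℝ (csupp (ν : Measure (EuclideanSpace ℝ (Fin d))))) :
    (convexDim C = (d : ℤ) - 1 →
      (∀ S : Set (EuclideanSpace ℝ (Fin d)), IsCompact S →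
        Disjoint S (affineSpan ℝ C : Set (EuclideanSpace ℝ (Fin d))) →
        Tendsto (fun n => ⨆ x ∈ S, f n x) atTop (𝓝 0)) ∧
      csupp (ν : Measure (EuclideanSpace ℝ (Fin d))) ⊆ affineSpan ℝ C) ∧
    ((ν : Measure (EuclideanSpace ℝ (Fin d))) ≪ lebesgueOn A ∧
      (ν : Measure (EuclideanSpace ℝ (Fin d))) = (lebesgueOn A).withDensity
        (clOn A (fun x => liminf (fun n => marginalOn A (f n) x) atTop)) ∧
      IsLogConcaveDensity A (lebesgueOn A)
        (clOn A (fun x => liminf (fun n => marginalOn A (f n) x) atTop))) := by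
  have hu : ∀ n, LogConcave (f n) := fun n => (hf n).logConcave_univ
  have hC' : C = posSet f := hC
  subst hC'
  obtain ⟨hden, hlc⟩ := limit_density_on_affineSpan_csupp hf hνs hν hA
  refine ⟨fun hdim => ⟨fun S hS hSd =>
    tendsto_iSup_of_disjoint_affineSpan_posSet hu hνs hν hdim hS hSd,
    csupp_subset_affineSpan_posSet hu hνs hν hdim⟩, ?_, hden, hlc⟩
  rw [hden]
  exact withDensity_absolutelyContinuous _ _
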